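/- On $L^2(\mathbb R)$ let $\hat x$ be multiplication by $x$ and $\hat p=-i\,d/dx$, and let $D(\alpha,\beta)=\exp(i\sqrt2\,\beta\hat x-i\sqrt2\,\alpha\hat p)$, i.e. $(D(\alpha,\beta)f)(x)=e^{i\sqrt2\beta x-i\alpha\beta}f(x-\sqrt2\,\alpha)$. For real $x,y,\theta$ with $\sin\theta\ne0$ let $$\Delta(x,y;\theta)=\Big[\tfrac{1+i\cot\theta}{2\pi}\Big]^{1/2}\exp\Big[-\tfrac{i(x^2+y^2)\cot\theta}{2}+\tfrac{ixy}{\sin\theta}\Big]$$ (principal square root), and let $\Delta(x,y;\theta)=\delta(x-y)$ if $\theta\in2\pi\mathbb Z$ and $\Delta(x,y;\theta)=\delta(x+y)$ if $\theta\in\pi+2\pi\mathbb Z$. Let $\mathfrak T=\{(\theta_1,\theta_2)\in[0,\pi)^2:\theta_1-\theta_2\ne\pm\pi/2\}$, and for $(\alpha,\beta;\theta_1,\theta_2)\in\mathbb R\times\mathbb R\times\mathfrak T$ let the bifractional displacement operator be $$U(\alpha,\beta;\theta_1,\theta_2)=|\cos(\theta_1-\theta_2)|^{1/2}\int d\alpha'd\beta'\,\Delta(\beta,\alpha';\theta_2)\,\Delta(\alpha,-\beta';\theta_1)\,D(\alpha',\beta').$$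 All operator integrals are understood weakly: $\int k\,F=A$ means that $\int k(s,t)\langle f,F(s,t)g\rangle\,ds\,dt$ converges absolutely and equals $\langle f,Ag\rangle$ for all Schwartz functions $f,g$. Let $\mathcal B$ be the set of all operators $U(\alpha,\beta;\theta_1,\theta_2)$. For $x=(\alpha,\beta;\theta_1,\theta_2)$ and $y=(\gamma,\delta;\phi_1,\phi_2)$ in $\mathbb R\times\mathbb R\times\mathfrak T$ write $U_x$, $U_y$ for the corresponding operators, and let $T(x|y)$ be the map with domain $\{U_x\}$ whose value is $$\frac{|\cos(\phi_1-\phi_2)|^{1/2}}{|\cos(\theta_1-\theta_2)|^{1/2}}\int d\alpha\,d\beta\,\Delta(\beta,\delta;\phi_2-\theta_2)\,\Delta(\alpha,\gamma;\phi_1-\theta_1)\,U(\alpha,\beta;\theta_1,\theta_2).$$ Then: 1. the integrals defining $U_x$ and $T(x|y)$ exist as bounded operators, $U_x$ is unitary, and $T(x|y)$ sends $U_x$ to $U_y$; 2. (compatibility) for all angle pairs $\theta,\phi,\psi\in\mathfrak T$, applying the above integral transform from $\phi$ to $\psi$ to the family $(\gamma,\delta)\mapsto$ (integral transform from $\theta$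 to $\phi$ of $U(\cdot,\cdot;\theta_1,\theta_2)$ at $(\gamma,\delta)$) gives the integral transform from $\theta$ to $\psi$ of $U(\cdot,\cdot;\theta_1,\theta_2)$; and $T(x|y)$ followed by $T(y|z)$ is $T(x|z)$ for all $x,y,z$; 3. the set $\mathcal T$ of all maps $T(x|y)$ is a connected groupoid over the base set $\mathcal B$: the source of $T(x|y)$ is $U_x$ and its target is $U_y$; the product $t_1t_2$, defined when the target of $t_1$ is the source of $t_2$, is the composition ($t_1$ first, then $t_2$); the inverse of $T(x|y)$ is $T(y|x)$; the left identity $tt^{-1}$ and the right identity $t^{-1}t$ of $t=T(x|y)$ are $T(x|x)$ and $T(y|y)$; and any two elements of $\mathcal B$ are the source and the target of some element of $\mathcal T$. Here a groupoid $\mathcal T$ over $\mathcal B$ has source and target maps $s_1,s_2:\mathcal T\to\mathcal B$, an associative product $t_1t_2$ defined when $s_2(t_1)=s_1(t_2)$, with $s_1(t_1t_2)=s_1(t_1)$ and $s_2(t_1t_2)=s_2(t_2)$, and an involution $t\mapsto t^{-1}$ that exchanges source and target, such that $(tt^{-1})t=t=t(t^{-1}t)$, and such that $s_1$ restricts to a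 bijection from the set of left identities to $\mathcal B$ and to a bijection from the set of right identities to $\mathcal B$. -/

import Mathlib

open MeasureTheory
open scoped SchwartzMap InnerProductSpace

noncomputable section

namespace Bifractional

/-! ### The Hilbert space and the displacement operators -/

/-- The Hilbert space `L²(ℝ)` of the harmonic oscillator, in the position representation. -/
abbrev Hilb : Type := Lp ℂ 2 (volume : Measure ℝ)

/-- Bounded operators on `L²(ℝ)`. -/
abbrev Op : Type := Hilb →L[ℂ] Hilb

/-- The unimodular factor `exp(i√2 β x - i α β)`. -/
def dispPhase (α β x : ℝ) : ℂ :=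
  Complex.exp (Complex.I * ((√2 * β * x - α * β : ℝ) : ℂ))

/-- The action of `exp(i√2 β x̂ - i√2 α p̂)` (with `x̂` multiplication by `x`, and `p̂ = -i d/dx`)
on a wave function: `f(x) ↦ exp(i√2 β x - i α β) f(x - √2 α)`. -/
def dispFun (α β : ℝ) (f : ℝ → ℂ) (x : ℝ) : ℂ :=
  dispPhase α β x * f (x - √2 * α)

lemma norm_dispPhase (α β x : ℝ) : ‖dispPhase α β x‖ = 1 := by
  rw [dispPhase, mul_comm]
  exact Complex.norm_exp_ofReal_mul_I _

lemma continuous_dispPhase (α β : ℝ) : Continuous (dispPhase α β) := by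
  unfold dispPhase
  fun_prop

/-- `D(α,β) D(α',β') = exp(i (β α' - α β')) D(α+α', β+β')`; in particular `t ↦ D(tα,tβ)` is a
one-parameter group. -/
lemma dispFun_dispFun (α β α' β' : ℝ) (f : ℝ → ℂ) (x : ℝ) :
    dispFun α β (dispFun α' β' f) x
      = Complex.exp (Complex.I * ((β * α' - α * β' : ℝ) : ℂ))
        * dispFun (α + α') (β + β') f x := by
  have h2 : √2 * √2 = (2 : ℝ) := Real.mul_self_sqrt (by norm_num)
  have hx : x - √2 * α - √2 * α' = x - √2 * (α + α') := by ring
  unfold dispFun dispPhase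
  rw [hx, ← mul_assoc, ← mul_assoc, ← Complex.exp_add, ← Complex.exp_add, ← mul_add, ← mul_add,
    ← Complex.ofReal_add, ← Complex.ofReal_add]
  congr 4
  linear_combination (-(β' * α)) * h2

/-- The generator of `t ↦ D(tα,tβ)` is `i√2 β x̂ - i√2 α p̂`, where `p̂ f = -i f'`. -/
lemma hasDerivAt_dispFun (α β : ℝ) (f : ℝ → ℂ) (x : ℝ) (f' : ℂ) (hf : HasDerivAt f f' x) :
    HasDerivAt (fun t : ℝ => dispFun (t * α) (t * β) f x)
      (Complex.I * (√2 : ℝ) * β * (x * f x) - Complex.I * (√2 : ℝ) * α * (-Complex.I * f')) 0 := by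
  have h1 : HasDerivAt (fun t : ℝ => √2 * (t * β) * x - (t * α) * (t * β)) (√2 * β * x) 0 := by
    have ha : HasDerivAt (fun t : ℝ => t * (√2 * β * x)) (1 * (√2 * β * x)) 0 :=
      (hasDerivAt_id (0 : ℝ)).mul_const _
    have hb : HasDerivAt (fun t : ℝ => t ^ 2 * (α * β)) (((2 : ℕ) * (0 : ℝ) ^ (2 - 1)) * (α * β)) 0 :=
      (hasDerivAt_pow 2 (0 : ℝ)).mul_const _
    have hc := ha.sub hb
    refine (hc.congr_deriv (by simp)).congr_of_eventuallyEq (Filter.Eventually.of_forall ?_)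
    intro t
    simp only [Pi.sub_apply]
    ring
  have h2 : HasDerivAt (fun t : ℝ => dispPhase (t * α) (t * β) x)
      (Complex.I * (√2 * β * x : ℝ)) 0 := by
    have := (h1.ofReal_comp.const_mul Complex.I).cexp
    simpa [dispPhase] using this
  have h3 : HasDerivAt (fun t : ℝ => x - √2 * (t * α)) (-(√2 * α)) 0 := by
    have ha : HasDerivAt (fun t : ℝ => t * (√2 * α)) (1 * (√2 * α)) 0 :=
      (hasDerivAt_id (0 : ℝ)).mul_const _
    refine ((ha.const_sub x).congr_deriv (by simp)).congr_of_eventuallyEq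
      (Filter.Eventually.of_forall ?_)
    intro t
    simp only
    ring
  have hf0 : HasDerivAt f f' (x - √2 * (0 * α)) := by simpa using hf
  have h4 : HasDerivAt (fun t : ℝ => f (x - √2 * (t * α))) ((-(√2 * α)) • f') 0 :=
    HasDerivAt.scomp (0 : ℝ) hf0 h3
  have h5 := h2.mul h4
  refine h5.congr_deriv ?_
  simp [dispPhase]
  linear_combination ((√2 : ℝ) : ℂ) * α * f' * (-Complex.I_mul_I)

lemma memLp_dispFun (α β : ℝ) (f : Hilb) :
    MemLp (dispFun α β f) 2 (volume : Measure ℝ) := by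
  have h : MemLp (fun x => f (x - √2 * α)) 2 (volume : Measure ℝ) :=
    (Lp.memLp f).comp_measurePreserving (measurePreserving_sub_right volume (√2 * α))
  refine h.of_le ((continuous_dispPhase α β).aestronglyMeasurable.mul h.1) ?_
  exact Filter.Eventually.of_forall fun x => by
    simp [dispFun, norm_dispPhase]

lemma dispFun_congr_ae (α β : ℝ) {f g : ℝ → ℂ} (h : f =ᵐ[volume] g) :
    dispFun α β f =ᵐ[volume] dispFun α β g := by
  have := (measurePreserving_sub_right (volume : Measure ℝ) (√2 * α)).quasiMeasurePreserving.ae_eq h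
  filter_upwards [this] with x hx
  simp only [Function.comp_apply] at hx
  simp [dispFun, hx]

/-- The displacement operator `D(α,β) = exp(i√2 β x̂ - i√2 α p̂)`, as a linear isometry of
`L²(ℝ)`. -/
def dispIsometry (α β : ℝ) : Hilb →ₗᵢ[ℂ] Hilb where
  toFun f := (memLp_dispFun α β f).toLp _
  map_add' f g := by
    rw [← MemLp.toLp_add]
    refine MemLp.toLp_congr _ _ ((dispFun_congr_ae α β (Lp.coeFn_add f g)).trans ?_)
    exact Filter.Eventually.of_forall fun x => by simp [dispFun, mul_add]
  map_smul' c f := by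
    rw [RingHom.id_apply, ← MemLp.toLp_const_smul]
    refine MemLp.toLp_congr _ _ ((dispFun_congr_ae α β (Lp.coeFn_smul c f)).trans ?_)
    exact Filter.Eventually.of_forall fun x => by simp [dispFun, mul_left_comm]
  norm_map' f := by
    change ‖(memLp_dispFun α β f).toLp _‖ = ‖f‖
    rw [Lp.norm_toLp, Lp.norm_def]
    congr 1
    rw [← eLpNorm_comp_measurePreserving (Lp.aestronglyMeasurable f)
      (measurePreserving_sub_right (volume : Measure ℝ) (√2 * α))]
    refine eLpNorm_congr_norm_ae (Filter.Eventually.of_forall fun x => ?_)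
    simp [dispFun, norm_dispPhase]

/-- The displacement operator `D(α,β)` as a bounded operator. -/
def D (α β : ℝ) : Op := (dispIsometry α β).toContinuousLinearMap

lemma coeFn_D (α β : ℝ) (f : Hilb) : D α β f =ᵐ[volume] dispFun α β f :=
  MemLp.coeFn_toLp (memLp_dispFun α β f)

/-! ### The fractional Fourier kernel

`Δ(x,y;θ) = [(1 + i cot θ)/(2π)]^{1/2} exp(-i (x² + y²) cot θ / 2 + i x y / sin θ)` when
`sin θ ≠ 0` (principal square root), while `Δ(x,y;θ) = δ(x - y)` for `θ = 0` and
`Δ(x,y;θ) = δ(x + y)` for `θ = π` (modulo `2π`). To treat both cases at once, `Δ(x,y;θ) dy` is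
`kernelDensity x y θ` times the measure `kernelMeasure x θ` in the variable `y`. -/

/-- The factor of the fractional Fourier kernel that is a function. -/
def kernelDensity (x y θ : ℝ) : ℂ :=
  if Real.sin θ = 0 then 1
  else ((1 + Complex.I * (Real.cot θ : ℂ)) / (2 * Real.pi : ℂ)) ^ (1 / 2 : ℂ)
    * Complex.exp (-Complex.I * ((x : ℂ) ^ 2 + (y : ℂ) ^ 2) * (Real.cot θ : ℂ) / 2
        + Complex.I * (x : ℂ) * (y : ℂ) / (Real.sin θ : ℂ))

/-- Lebesgue measure, or, when `sin θ = 0` (and so `cos θ = ±1`), the Dirac mass at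
`y = (cos θ) x`. -/
def kernelMeasure (x θ : ℝ) : Measure ℝ :=
  if Real.sin θ = 0 then Measure.dirac (Real.cos θ * x) else volume

/-- The kernel is symmetric in its two variables. -/
lemma kernelDensity_symm (x y θ : ℝ) : kernelDensity x y θ = kernelDensity y x θ := by
  unfold kernelDensity
  congr 3
  ring

/-- `Δ(x,-y;θ) = Δ(-x,y;θ)`. -/
lemma kernelDensity_neg (x y θ : ℝ) : kernelDensity x (-y) θ = kernelDensity (-x) y θ := by
  unfold kernelDensity
  congr 3
  push_cast
  ring

/-! ### Operator-valued kernel integrals -/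

/-- `A = ∫ ds dt Δ(a,s;θ) Δ(b,t;φ) F(s,t)`, as a weak operator integral: for all Schwartz functions
`f, g`, the matrix element `⟨f, F(s,t) g⟩` is integrable against the product of the two kernels, and
its integral is `⟨f, A g⟩`. -/
def HasKernelIntegral (F : ℝ → ℝ → Op) (θ φ a b : ℝ) (A : Op) : Prop :=
  ∀ f g : 𝓢(ℝ, ℂ),
    Integrable (fun p : ℝ × ℝ => kernelDensity a p.1 θ * kernelDensity b p.2 φ
        * ⟪f.toLp 2 volume, F p.1 p.2 (g.toLp 2 volume)⟫_ℂ)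
      ((kernelMeasure a θ).prod (kernelMeasure b φ)) ∧
    ∫ p : ℝ × ℝ, kernelDensity a p.1 θ * kernelDensity b p.2 φ
        * ⟪f.toLp 2 volume, F p.1 p.2 (g.toLp 2 volume)⟫_ℂ
      ∂((kernelMeasure a θ).prod (kernelMeasure b φ))
      = ⟪f.toLp 2 volume, A (g.toLp 2 volume)⟫_ℂ

/-- A kernel integral has at most one value, because the Schwartz functions are dense. -/
lemma HasKernelIntegral.unique {F : ℝ → ℝ → Op} {θ φ a b : ℝ} {A B : Op}
    (hA : HasKernelIntegral F θ φ a b A) (hB : HasKernelIntegral F θ φ a b B) : A = B := by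
  have hd : DenseRange (SchwartzMap.toLpCLM ℂ (E := ℝ) ℂ 2 (volume : Measure ℝ)) :=
    SchwartzMap.denseRange_toLpCLM ENNReal.ofNat_ne_top
  have key : ∀ g : 𝓢(ℝ, ℂ), A (g.toLp 2 volume) = B (g.toLp 2 volume) := by
    intro g
    refine hd.eq_of_inner_right ℂ fun f => ?_
    exact ((hA f g).2.symm.trans (hB f g).2)
  have : (A : Hilb → Hilb) = B :=
    hd.equalizer A.continuous B.continuous (funext fun g => key g)
  exact DFunLike.coe_injective this

open Classical in
/-- The operator `∫ ds dt Δ(a,s;θ) Δ(b,t;φ) F(s,t)` (and `0` if there is no such operator). -/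
def kernelIntegral (F : ℝ → ℝ → Op) (θ φ a b : ℝ) : Op :=
  if h : ∃ A, HasKernelIntegral F θ φ a b A then h.choose else 0

/-! ### Bifractional displacement operators -/

/-- The operator
`U(α,β;θ₁,θ₂) = |cos(θ₁-θ₂)|^{1/2} ∫ dα' dβ' Δ(β,α';θ₂) Δ(α,-β';θ₁) D(α',β')`,
where `Δ(α,-β';θ₁) = Δ(-α,β';θ₁)`. -/
def U (α β θ₁ θ₂ : ℝ) : Op :=
  ((√|Real.cos (θ₁ - θ₂)| : ℝ) : ℂ) • kernelIntegral D θ₂ θ₁ β (-α)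

/-- `𝔗 = [0,π) × [0,π)` without the lines `θ₁ - θ₂ = ± π/2`. -/
def angleDomain : Set (ℝ × ℝ) :=
  {θ | θ ∈ Set.Ico 0 Real.pi ×ˢ Set.Ico 0 Real.pi ∧
    θ.1 - θ.2 ≠ Real.pi / 2 ∧ θ.1 - θ.2 ≠ -(Real.pi / 2)}

/-- The parameters `(α,β;θ₁,θ₂) ∈ ℝ × ℝ × 𝔗`. -/
structure Param where
  α : ℝ
  β : ℝ
  θ : ℝ × ℝ
  mem : θ ∈ angleDomain

/-- The family `(α,β) ↦ U(α,β;θ₁,θ₂)`, for fixed angles. -/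
def family (θ : ℝ × ℝ) : ℝ → ℝ → Op := fun α β => U α β θ.1 θ.2

/-- The operator `U(α,β;θ₁,θ₂)` with parameters in `ℝ × ℝ × 𝔗`. -/
def Param.U (x : Param) : Op := family x.θ x.α x.β

/-- The base set `ℬ` of bifractional displacement operators. -/
def base : Set Op := Set.range Param.U

/-! ### The transformations -/

/-- The fractional Fourier transform of a family of operators, which goes from the angles `θ` to the
angles `φ`: its value at `(γ,δ)` is
`|cos(φ₁-φ₂)|^{1/2} / |cos(θ₁-θ₂)|^{1/2} ∫ dα dβ Δ(β,δ;φ₂-θ₂) Δ(α,γ;φ₁-θ₁) F(α,β)`. -/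
def transform (θ φ : ℝ × ℝ) (F : ℝ → ℝ → Op) : ℝ → ℝ → Op := fun γ δ =>
  ((√|Real.cos (φ.1 - φ.2)| / √|Real.cos (θ.1 - θ.2)| : ℝ) : ℂ) •
    kernelIntegral F (φ.1 - θ.1) (φ.2 - θ.2) γ δ

/-- The map `T(x|y)`: it is defined on `U(α,β;θ₁,θ₂)` only, where `x = (α,β;θ₁,θ₂)`, and its value
there is given by the integral formula, evaluated at the parameters `y = (γ,δ;φ₁,φ₂)`. -/
def T (x y : Param) : Op →. Op := fun A =>
  ⟨A = x.U, fun _ => transform x.θ y.θ (family x.θ) y.α y.β⟩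

/-- The set `𝒯` of all the maps `T(x|y)`. -/
def arrows : Set (Op →. Op) := {t | ∃ x y : Param, t = T x y}

/-- Every `T(x|y)`, as an element of `𝒯`. -/
def arrow (x y : Param) : arrows := ⟨T x y, x, y, rfl⟩

/-- Every `U(α,β;θ₁,θ₂)`, as an element of `ℬ`. -/
def point (x : Param) : base := ⟨x.U, x, rfl⟩

/-! ### Groupoids over a base set -/

/-- A groupoid: a set `𝒯` of arrows over a base set `ℬ`. The product `t₁ t₂` is defined when the
target of `t₁` is the source of `t₂`. -/
structure GroupoidOver (𝒯 ℬ : Type) where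
  /-- the source `s₁` -/
  src : 𝒯 → ℬ
  /-- the target `s₂` -/
  tgt : 𝒯 → ℬ
  /-- the partial multiplication -/
  mul : ∀ t₁ t₂ : 𝒯, tgt t₁ = src t₂ → 𝒯
  src_mul : ∀ t₁ t₂ h, src (mul t₁ t₂ h) = src t₁
  tgt_mul : ∀ t₁ t₂ h, tgt (mul t₁ t₂ h) = tgt t₂
  mul_assoc : ∀ t₁ t₂ t₃ (h₁₂ : tgt t₁ = src t₂) (h₂₃ : tgt t₂ = src t₃),
    mul (mul t₁ t₂ h₁₂) t₃ ((tgt_mul t₁ t₂ h₁₂).trans h₂₃)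
      = mul t₁ (mul t₂ t₃ h₂₃) (h₁₂.trans (src_mul t₂ t₃ h₂₃).symm)
  /-- the inverse -/
  inv : 𝒯 → 𝒯
  inv_inv : ∀ t, inv (inv t) = t
  src_inv : ∀ t, src (inv t) = tgt t
  tgt_inv : ∀ t, tgt (inv t) = src t
  leftId_mul : ∀ t, mul (mul t (inv t) (src_inv t).symm) t
    ((tgt_mul t (inv t) (src_inv t).symm).trans (tgt_inv t)) = t
  mul_rightId : ∀ t, mul t (mul (inv t) t (tgt_inv t))
    ((src_inv t).symm.trans (src_mul (inv t) t (tgt_inv t)).symm) = t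
  /-- the source map is a bijection from the set of the left identities `t t⁻¹` to the base -/
  bijOn_leftId : Set.BijOn src
    (Set.range fun t => mul t (inv t) (src_inv t).symm) Set.univ
  /-- the source map is a bijection from the set of the right identities `t⁻¹ t` to the base -/
  bijOn_rightId : Set.BijOn src
    (Set.range fun t => mul (inv t) t (tgt_inv t)) Set.univ

namespace GroupoidOver

variable {𝒯 ℬ : Type} (G : GroupoidOver 𝒯 ℬ)

/-- The left identity `L_t = t t⁻¹`. -/
def leftId (t : 𝒯) : 𝒯 := G.mul t (G.inv t) (G.src_inv t).symm

/-- The right identity `R_t = t⁻¹ t`. -/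
def rightId (t : 𝒯) : 𝒯 := G.mul (G.inv t) t (G.tgt_inv t)

/-- A groupoid is connected (transitive) when any two points of the base are joined by an arrow. -/
def IsConnected : Prop := ∀ u₁ u₂ : ℬ, ∃ t : 𝒯, G.src t = u₁ ∧ G.tgt t = u₂

end GroupoidOver

end Bifractional

end

noncomputable section

namespace Bifractional

open Complex Filter Topology ComplexConjugate

/-! Everything is read off matrix elements between Schwartz functions. Put H(s,t) = conj f((t-s)/√2)
g(-(s+t)/√2), a Schwartz function on the plane (`crossProduct`). Then ⟨f, D(a,b) g⟩ is √π times the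
fractional Fourier transform of H of angle π/2 in the first variable, at (-b,a) (`inner_D`). The
integral defining U applies two more such transforms, so ⟨f, U(α,β;θ₁,θ₂) g⟩ is √π
|cos(θ₁-θ₂)|^{1/2} times the transform of H with angles π/2 + θ₁ and θ₂, at (α,β). The integral in
T(x|y) adds the angle differences φ₁-θ₁ and φ₂-θ₂, hence it turns one family into the other
(`hasKernelIntegral_family`).

The analytic core is therefore additivity of the angles, `frft_frft`: two chirp integrals compose by
a Gaussian integral with imaginary exponent, or by Fourier inversion when the angles add up to a
multiple of π. The principal square roots must multiply without a sign (`frftConst_mul`). Schwartz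
functions of two variables are stable under the partial transforms
(`IsSchwartz.isSchwartz_frftFst`), which makes all the integrals absolutely convergent.

For unitarity, the arguments of f and g are taken as coordinates. With ω = π/2 + θ₁ and τ = θ₂, the
kernel of U becomes chirp(x) exp(iκxy) chirp(y), where κ is a nonzero multiple of sin(ω-τ) =
cos(θ₁-θ₂). So U is a product of unimodular multiplications and a rescaled Fourier transform. If sin
ω or sin τ vanishes, it is a chirp times a translation, possibly reflected (`exists_unitary`).

Once the families are known to be carried into each other, T(x|y) is just the partial map with
domain {U_x} and value U_y. It depends only on these two operators, and 𝒯 is the pair groupoid of ℬ.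
-/

/-! ### Plane waves and imaginary Gaussian integrals. -/

/-- The plane wave `exp(i t)`. -/
def phase (t : ℝ) : ℂ := Complex.exp (I * (t : ℂ))

lemma norm_phase (t : ℝ) : ‖phase t‖ = 1 := by
  rw [phase, mul_comm]
  exact norm_exp_ofReal_mul_I t

lemma phase_zero : phase 0 = 1 := by simp [phase]

lemma phase_add (s t : ℝ) : phase (s + t) = phase s * phase t := by
  rw [phase, phase, phase, ← Complex.exp_add]
  push_cast
  ring_nf

lemma phase_mul_phase_neg (t : ℝ) : phase t * phase (-t) = 1 := by
  rw [← phase_add, add_neg_cancel, phase_zero]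

@[fun_prop]
lemma continuous_phase : Continuous phase := by
  unfold phase
  fun_prop

lemma integrable_phase_mul {α : Type*} [MeasurableSpace α] {μ : Measure α}
    {f : α → ℂ} (hf : Integrable f μ) {q : α → ℝ} (hq : Measurable q) :
    Integrable (fun x => phase (q x) * f x) μ := by
  refine hf.bdd_mul (c := 1) (continuous_phase.measurable.comp hq).aestronglyMeasurable ?_
  exact Eventually.of_forall fun x => by simp [norm_phase]

/-- **Parseval's identity for an imaginary Gaussian.** -/
theorem integral_phase_mul_integral_phase {F : ℝ → ℂ} (hF : Integrable F) (κ : ℝ)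
    (hG : Integrable fun x => ∫ y, phase (κ * x * y) * F y) {σ : ℝ} (hσ : σ ≠ 0) (w : ℝ) :
    ∫ x, phase (-(σ / 2) * x ^ 2 + w * x) * ∫ y, phase (κ * x * y) * F y
      = (2 * Real.pi / (I * σ) : ℂ) ^ (1 / 2 : ℂ)
        * ∫ y, phase ((w + κ * y) ^ 2 / (2 * σ)) * F y := by
  set G : ℝ → ℂ := fun x => ∫ y, phase (κ * x * y) * F y with hGdef
  -- The double integral does not converge absolutely. A damping exp(-ε x²) gives a Gaussian of
  -- positive real part ε, for which Fubini applies; then ε → 0⁺ by dominated convergence, with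
  -- majorants |G| on the left and |F| on the right.
  let b : ℝ → ℂ := fun ε => ε + I * (σ / 2 : ℝ)
  have hbre : ∀ ε, (b ε).re = ε := fun ε => by simp [b]
  have hb0 : b 0 = I * (σ / 2 : ℝ) := by simp [b]
  have hb0ne : b 0 ≠ 0 := by
    rw [hb0]
    simp [hσ]
  have hbc : Continuous b := by fun_prop
  have key : ∀ ε : ℝ, 0 < ε →
      ∫ x : ℝ, Complex.exp (-(b ε) * (x : ℂ) ^ 2) * (phase (w * x) * G x)
        = ∫ y, (Real.pi / b ε) ^ (1 / 2 : ℂ)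
            * Complex.exp (-((w + κ * y : ℝ) : ℂ) ^ 2 / (4 * b ε)) * F y := by
    intro ε hε
    have hre : 0 < (b ε).re := by rw [hbre]; exact hε
    have hint : Integrable (fun p : ℝ × ℝ =>
        phase (w * p.1 + κ * p.1 * p.2) * (Complex.exp (-(b ε) * (p.1 : ℂ) ^ 2) * F p.2))
        (volume.prod volume) := by
      refine integrable_phase_mul ?_ (by fun_prop)
      exact (integrable_cexp_neg_mul_sq hre).mul_prod hF
    have h1 : ∀ x : ℝ, Complex.exp (-(b ε) * x ^ 2) * (phase (w * x) * G x)
        = ∫ y, phase (w * x + κ * x * y) * (Complex.exp (-(b ε) * (x : ℂ) ^ 2) * F y) := by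
      intro x
      rw [hGdef, ← integral_const_mul, ← integral_const_mul]
      refine integral_congr_ae (Eventually.of_forall fun y => ?_)
      simp only [phase_add]
      ring
    simp_rw [h1]
    rw [integral_integral_swap hint]
    refine integral_congr_ae (Eventually.of_forall fun y => ?_)
    simp only
    rw [← fourierIntegral_gaussian hre, ← integral_mul_const]
    refine integral_congr_ae (Eventually.of_forall fun x => ?_)
    simp only [phase]
    rw [← mul_assoc]
    congr 3
    push_cast
    ring
  have hl : Tendsto
      (fun ε => ∫ x : ℝ, Complex.exp (-(b ε) * (x : ℂ) ^ 2) * (phase (w * x) * G x)) (𝓝[>] 0)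
      (𝓝 (∫ x : ℝ, Complex.exp (-(b 0) * (x : ℂ) ^ 2) * (phase (w * x) * G x))) := by
    refine tendsto_integral_filter_of_dominated_convergence (fun x => ‖G x‖) ?_ ?_ hG.norm ?_
    · refine Eventually.of_forall fun ε => ?_
      refine AEStronglyMeasurable.mul (by fun_prop) ?_
      exact (integrable_phase_mul hG (by fun_prop)).1
    · filter_upwards [self_mem_nhdsWithin] with ε hε
      refine Eventually.of_forall fun x => ?_
      rw [norm_mul, norm_mul, norm_phase, one_mul, Complex.norm_exp]
      refine mul_le_of_le_one_left (norm_nonneg _) (Real.exp_le_one_iff.2 ?_)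
      have : (-(b ε) * (x : ℂ) ^ 2).re = -(ε * x ^ 2) := by
        rw [← ofReal_pow, re_mul_ofReal, neg_re, hbre]
        ring
      rw [this]
      have : 0 < ε := hε
      have : 0 ≤ ε * x ^ 2 := by positivity
      linarith
    · refine Eventually.of_forall fun x => ?_
      refine tendsto_nhdsWithin_of_tendsto_nhds ?_
      exact Continuous.tendsto (by fun_prop) 0
  have hr : Tendsto (fun ε => ∫ y, (Real.pi / b ε) ^ (1 / 2 : ℂ)
            * Complex.exp (-((w + κ * y : ℝ) : ℂ) ^ 2 / (4 * b ε)) * F y) (𝓝[>] 0)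
      (𝓝 ((Real.pi / b 0) ^ (1 / 2 : ℂ)
        * ∫ y, Complex.exp (-((w + κ * y : ℝ) : ℂ) ^ 2 / (4 * b 0)) * F y)) := by
    simp_rw [mul_assoc, integral_const_mul]
    refine Tendsto.mul ?_ ?_
    · refine tendsto_nhdsWithin_of_tendsto_nhds ?_
      refine ContinuousAt.tendsto (f := fun ε => (Real.pi / b ε) ^ (1 / 2 : ℂ)) ?_
      refine ContinuousAt.cpow (ContinuousAt.div (by fun_prop) hbc.continuousAt hb0ne)
        continuousAt_const ?_
      -- In the limit π / b is a nonzero imaginary number, away from the cut of the principal root.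
      refine Complex.mem_slitPlane_iff.2 (Or.inr ?_)
      rw [hb0]
      have : (Real.pi / (I * (σ / 2 : ℝ)) : ℂ) = ((-(2 * Real.pi / σ) : ℝ) : ℂ) * I := by
        have : (σ : ℂ) ≠ 0 := by exact_mod_cast hσ
        push_cast
        field_simp
        rw [I_sq]
        norm_num
      rw [this]
      simp [hσ, Real.pi_ne_zero]
    · refine tendsto_integral_filter_of_dominated_convergence (fun x => ‖F x‖) ?_ ?_ hF.norm ?_
      · refine Eventually.of_forall fun ε => ?_
        refine AEStronglyMeasurable.mul (by fun_prop) hF.1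
      · filter_upwards [self_mem_nhdsWithin] with ε hε
        refine Eventually.of_forall fun x => ?_
        rw [norm_mul, Complex.norm_exp]
        refine mul_le_of_le_one_left (norm_nonneg _) (Real.exp_le_one_iff.2 ?_)
        have hε' : 0 < ε := hε
        have h4 : (0 : ℝ) ≤ (((4 : ℂ) * b ε)⁻¹).re := by
          rw [inv_re]
          refine div_nonneg ?_ (normSq_nonneg _)
          have : ((4 : ℂ) * b ε).re = 4 * ε := by simp [b]
          rw [this]
          positivity
        have : (-((w + κ * x : ℝ) : ℂ) ^ 2 / (4 * b ε)).re
            = -((w + κ * x) ^ 2 * (((4 : ℂ) * b ε)⁻¹).re) := by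
          rw [div_eq_mul_inv, neg_mul, neg_re, ← ofReal_pow, re_ofReal_mul]
        rw [this]
        have : 0 ≤ (w + κ * x) ^ 2 * (((4 : ℂ) * b ε)⁻¹).re := by positivity
        linarith
      · refine Eventually.of_forall fun y => ?_
        refine tendsto_nhdsWithin_of_tendsto_nhds ?_
        refine ContinuousAt.tendsto (f := fun ε =>
          Complex.exp (-((w + κ * y : ℝ) : ℂ) ^ 2 / (4 * b ε)) * F y) ?_
        refine ContinuousAt.mul (ContinuousAt.cexp ?_) continuousAt_const
        refine ContinuousAt.div (by fun_prop) (by fun_prop) ?_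
        simpa using hb0ne
  have heq := tendsto_nhds_unique (hl.congr' (by
    filter_upwards [self_mem_nhdsWithin] with ε hε using key ε hε)) hr
  have hσc : (σ : ℂ) ≠ 0 := by exact_mod_cast hσ
  convert! heq using 2
  · ext x
    rw [← mul_assoc]
    congr 1
    rw [phase_add]
    congr 1
    rw [phase, hb0]
    congr 1
    push_cast
    ring
  · congr 1
    rw [hb0]
    push_cast
    field_simp
  · congr 1
    ext y
    congr 1
    rw [phase, hb0]
    congr 1
    push_cast
    field_simp
    rw [I_sq]
    ring

/-! ### The normalization constant and the branch of its square root. -/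

lemma cpow_half_mul {x y : ℂ} (hx : x ≠ 0) (hy : y ≠ 0)
    (h : arg x + arg y ∈ Set.Ioc (-Real.pi) Real.pi) :
    (x * y) ^ (1 / 2 : ℂ) = x ^ (1 / 2 : ℂ) * y ^ (1 / 2 : ℂ) := by
  rw [cpow_def_of_ne_zero (mul_ne_zero hx hy), cpow_def_of_ne_zero hx, cpow_def_of_ne_zero hy,
    Complex.log_mul hx hy h, add_mul, Complex.exp_add]

/-- The normalization of the fractional Fourier kernel. -/
def frftConst (θ : ℝ) : ℂ := ((1 + I * (Real.cot θ : ℂ)) / (2 * Real.pi : ℂ)) ^ (1 / 2 : ℂ)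

lemma frftConst_base_eq (θ : ℝ) : (1 + I * (Real.cot θ : ℂ)) / (2 * Real.pi : ℂ)
    = ⟨1 / (2 * Real.pi), Real.cot θ / (2 * Real.pi)⟩ := by
  have h : (Real.pi : ℂ) ≠ 0 := by exact_mod_cast Real.pi_ne_zero
  rw [mk_eq_add_mul_I]
  push_cast
  field_simp

lemma frftConst_base_ne_zero (θ : ℝ) : (1 + I * (Real.cot θ : ℂ)) / (2 * Real.pi : ℂ) ≠ 0 := by
  rw [frftConst_base_eq]
  intro h
  have := congrArg Complex.re h
  simp at this

lemma abs_arg_frftConst_base (θ : ℝ) :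
    |arg ((1 + I * (Real.cot θ : ℂ)) / (2 * Real.pi : ℂ))| < Real.pi / 2 := by
  rw [abs_arg_lt_pi_div_two_iff, frftConst_base_eq]
  left
  have := Real.pi_pos
  simp only
  positivity

/-- The modulus of 1 + i cot θ is 1/|sin θ|. -/
lemma norm_frftConst_sq {θ : ℝ} (hθ : Real.sin θ ≠ 0) :
    ‖frftConst θ‖ ^ 2 = 1 / (2 * Real.pi * |Real.sin θ|) := by
  have hp := Real.pi_pos
  have hs : 0 < |Real.sin θ| := abs_pos.2 hθ
  have h1 : frftConst θ ^ 2 = (1 + I * (Real.cot θ : ℂ)) / (2 * Real.pi : ℂ) := by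
    rw [frftConst, ← cpow_nat_mul]
    norm_num
  rw [← norm_pow, h1, frftConst_base_eq]
  refine (sq_eq_sq₀ (norm_nonneg _) (by positivity)).1 ?_
  rw [← normSq_eq_norm_sq, normSq_mk, Real.cot_eq_cos_div_sin, div_pow 1, mul_pow _ |_|, sq_abs]
  field_simp
  linarith [Real.sin_sq_add_cos_sq θ]

/-- Here cot φ = -cot θ, so the two constants are complex conjugates and their product is a squared
modulus. This is the constant of Fourier inversion. -/
lemma frftConst_mul_of_sin_add_eq_zero {θ φ : ℝ} (hθ : Real.sin θ ≠ 0) (hφ : Real.sin φ ≠ 0)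
    (h : Real.sin (θ + φ) = 0) :
    frftConst θ * frftConst φ * (2 * Real.pi * |Real.sin θ| : ℝ) = 1 := by
  have hcot : Real.cot φ = - Real.cot θ := by
    rw [Real.cot_eq_cos_div_sin, Real.cot_eq_cos_div_sin]
    rw [Real.sin_add] at h
    field_simp
    linarith
  have hconj : frftConst φ = (starRingEnd ℂ) (frftConst θ) := by
    have hb : (1 + I * (Real.cot φ : ℂ)) / (2 * Real.pi : ℂ)
        = (starRingEnd ℂ) ((1 + I * (Real.cot θ : ℂ)) / (2 * Real.pi : ℂ)) := by
      rw [frftConst_base_eq, frftConst_base_eq, hcot]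
      apply Complex.ext
      · simp
      · simp [neg_div]
    rw [frftConst, frftConst, hb, conj_cpow _ _ ?_]
    · rw [map_div₀, map_one, Complex.conj_ofNat]
    · have := abs_lt.1 (abs_arg_frftConst_base θ)
      linarith [Real.pi_pos]
  rw [hconj, mul_conj, normSq_eq_norm_sq, norm_frftConst_sq hθ, ← ofReal_mul]
  have hp := Real.pi_pos
  have hs : 0 < |Real.sin θ| := abs_pos.2 hθ
  rw [one_div, inv_mul_cancel₀ (by positivity), ofReal_one]

lemma cot_add_cot {θ φ : ℝ} (hθ : Real.sin θ ≠ 0) (hφ : Real.sin φ ≠ 0) :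
    Real.cot θ + Real.cot φ = Real.sin (θ + φ) / (Real.sin θ * Real.sin φ) := by
  rw [Real.cot_eq_cos_div_sin, Real.cot_eq_cos_div_sin, Real.sin_add]
  field_simp
  ring

/-- Under the square roots this is the addition formula of the cotangent. No sign appears: the first
two bases x, y have arguments in (-π/2, π/2), and Im(xy) has the sign of σ while the third base lies
on the imaginary axis on the opposite side, so the arguments never leave the principal range. -/
lemma frftConst_mul {θ φ : ℝ} (hθ : Real.sin θ ≠ 0) (hφ : Real.sin φ ≠ 0)
    (h : Real.sin (θ + φ) ≠ 0) :
    frftConst θ * frftConst φ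
      * (2 * Real.pi / (I * ((Real.cot θ + Real.cot φ : ℝ) : ℂ)) : ℂ) ^ (1 / 2 : ℂ)
      = frftConst (θ + φ) := by
  have hp := Real.pi_pos
  set x := (1 + I * (Real.cot θ : ℂ)) / (2 * Real.pi : ℂ) with hx
  set y := (1 + I * (Real.cot φ : ℂ)) / (2 * Real.pi : ℂ) with hy
  set σ := Real.cot θ + Real.cot φ with hσdef
  have hσ : σ ≠ 0 := by
    rw [hσdef, cot_add_cot hθ hφ]
    exact div_ne_zero h (mul_ne_zero hθ hφ)
  have hσc : (σ : ℂ) ≠ 0 := by exact_mod_cast hσ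
  have hpc : (Real.pi : ℂ) ≠ 0 := by exact_mod_cast Real.pi_ne_zero
  have hx0 : x ≠ 0 := frftConst_base_ne_zero θ
  have hy0 : y ≠ 0 := frftConst_base_ne_zero φ
  have hxa := abs_lt.1 (abs_arg_frftConst_base θ)
  have hya := abs_lt.1 (abs_arg_frftConst_base φ)
  rw [← hx] at hxa
  rw [← hy] at hya
  set z := (2 * Real.pi / (I * (σ : ℂ)) : ℂ) with hz
  have hzeq : z = ⟨0, -(2 * Real.pi / σ)⟩ := by
    rw [mk_eq_add_mul_I, hz]
    push_cast
    field_simp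
    linear_combination (2 * Real.pi : ℂ) * I_sq
  have hz0 : z ≠ 0 := by
    rw [hz]
    exact div_ne_zero (mul_ne_zero two_ne_zero hpc) (mul_ne_zero I_ne_zero hσc)
  have hxyarg : arg x + arg y ∈ Set.Ioc (-Real.pi) Real.pi := ⟨by linarith, by linarith⟩
  have hxyim : (x * y).im = σ / (4 * Real.pi ^ 2) := by
    rw [hx, hy, frftConst_base_eq, frftConst_base_eq, mul_im]
    simp only
    rw [hσdef]
    field_simp
    ring
  have hxyz : arg (x * y) + arg z ∈ Set.Ioc (-Real.pi) Real.pi := by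
    rcases lt_or_gt_of_ne hσ with hneg | hpos
    · have h1 : arg (x * y) < 0 := by
        rw [arg_neg_iff, hxyim]
        exact div_neg_of_neg_of_pos hneg (by positivity)
      have h2 : arg z = Real.pi / 2 := by
        rw [arg_eq_pi_div_two_iff, hzeq]
        refine ⟨rfl, ?_⟩
        simp only
        have : 2 * Real.pi / σ < 0 := div_neg_of_pos_of_neg (by positivity) hneg
        linarith
      have h3 := neg_pi_lt_arg (x * y)
      constructor <;> linarith
    · have h1 : 0 ≤ arg (x * y) := by
        rw [arg_nonneg_iff, hxyim]
        positivity
      have h2 : arg z = -(Real.pi / 2) := by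
        rw [arg_eq_neg_pi_div_two_iff, hzeq]
        refine ⟨rfl, ?_⟩
        simp only
        have : 0 < 2 * Real.pi / σ := by positivity
        linarith
      have h3 := arg_le_pi (x * y)
      constructor <;> linarith
  rw [frftConst, frftConst, ← hx, ← hy, ← cpow_half_mul hx0 hy0 hxyarg,
    ← cpow_half_mul (mul_ne_zero hx0 hy0) hz0 hxyz, frftConst]
  congr 1
  have hcot : Real.cot (θ + φ) = (Real.cot θ * Real.cot φ - 1) / σ := by
    rw [hσdef, cot_add_cot hθ hφ, Real.cot_eq_cos_div_sin, Real.cot_eq_cos_div_sin,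
      Real.cot_eq_cos_div_sin, Real.cos_add]
    field_simp
  rw [hcot, hx, hy, hz]
  push_cast
  field_simp
  rw [hσdef]
  push_cast
  linear_combination I_sq

/-! ### The fractional Fourier transform on the line and its additivity. -/

lemma kernelDensity_of_sin_eq_zero {θ : ℝ} (hθ : Real.sin θ = 0) (x y : ℝ) :
    kernelDensity x y θ = 1 := if_pos hθ

lemma kernelDensity_of_sin_ne_zero {θ : ℝ} (hθ : Real.sin θ ≠ 0) (x y : ℝ) :
    kernelDensity x y θ = frftConst θ * phase (-(Real.cot θ / 2) * x ^ 2)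
      * phase (x / Real.sin θ * y) * phase (-(Real.cot θ / 2) * y ^ 2) := by
  rw [kernelDensity, if_neg hθ, ← frftConst, mul_assoc (frftConst θ), mul_assoc (frftConst θ), phase,
    phase, phase, ← Complex.exp_add, ← Complex.exp_add]
  congr 2
  push_cast
  ring

lemma kernelMeasure_of_sin_eq_zero {θ : ℝ} (hθ : Real.sin θ = 0) (x : ℝ) :
    kernelMeasure x θ = Measure.dirac (Real.cos θ * x) := if_pos hθ

lemma kernelMeasure_of_sin_ne_zero {θ : ℝ} (hθ : Real.sin θ ≠ 0) (x : ℝ) :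
    kernelMeasure x θ = volume := if_neg hθ

instance (x θ : ℝ) : SFinite (kernelMeasure x θ) := by
  unfold kernelMeasure
  split_ifs <;> infer_instance

@[fun_prop]
lemma continuous_kernelDensity {α : Type*} [TopologicalSpace α] {u v : α → ℝ} (hu : Continuous u)
    (hv : Continuous v) (θ : ℝ) : Continuous fun a => kernelDensity (u a) (v a) θ := by
  by_cases hθ : Real.sin θ = 0
  · simp_rw [kernelDensity_of_sin_eq_zero hθ]
    fun_prop
  · simp_rw [kernelDensity_of_sin_ne_zero hθ]
    fun_prop

/-- Only phases depend on x and y; this supplies the constant bound in the domination arguments. -/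
lemma norm_kernelDensity (x y θ : ℝ) : ‖kernelDensity x y θ‖ = ‖kernelDensity 0 0 θ‖ := by
  by_cases hθ : Real.sin θ = 0
  · simp_rw [kernelDensity_of_sin_eq_zero hθ]
  · simp_rw [kernelDensity_of_sin_ne_zero hθ]
    simp [norm_phase]

lemma sq_cos_eq_one {θ : ℝ} (hθ : Real.sin θ = 0) : Real.cos θ * Real.cos θ = 1 := by
  have := Real.sin_sq_add_cos_sq θ
  rw [hθ] at this
  linarith

lemma cos_eq_one_or_neg_one {θ : ℝ} (hθ : Real.sin θ = 0) :
    Real.cos θ = 1 ∨ Real.cos θ = -1 := mul_self_eq_one_iff.1 (sq_cos_eq_one hθ)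

/-- The fractional Fourier transform of a function. -/
def frft (θ : ℝ) (f : ℝ → ℂ) (x : ℝ) : ℂ := ∫ y, kernelDensity x y θ * f y ∂kernelMeasure x θ

lemma frft_of_sin_eq_zero {θ : ℝ} (hθ : Real.sin θ = 0) (f : ℝ → ℂ) (x : ℝ) :
    frft θ f x = f (Real.cos θ * x) := by
  simp [frft, kernelMeasure_of_sin_eq_zero hθ, kernelDensity_of_sin_eq_zero hθ]

lemma frft_of_sin_ne_zero {θ : ℝ} (hθ : Real.sin θ ≠ 0) (f : ℝ → ℂ) (x : ℝ) :
    frft θ f x = frftConst θ * phase (-(Real.cot θ / 2) * x ^ 2)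
      * ∫ y, phase (x / Real.sin θ * y) * (phase (-(Real.cot θ / 2) * y ^ 2) * f y) := by
  rw [frft, kernelMeasure_of_sin_ne_zero hθ, ← integral_const_mul]
  congr 1 with y
  rw [kernelDensity_of_sin_ne_zero hθ]
  ring

/-- The fractional Fourier transform commutes with the parity. -/
lemma frft_neg (θ : ℝ) (f : ℝ → ℂ) (x : ℝ) : frft θ f (-x) = frft θ (fun y => f (-y)) x := by
  by_cases hθ : Real.sin θ = 0
  · simp [frft_of_sin_eq_zero hθ]
  · rw [frft_of_sin_ne_zero hθ, frft_of_sin_ne_zero hθ, ← integral_neg_eq_self]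
    simp [neg_div]

lemma frft_const_mul (θ : ℝ) (c : ℂ) (f : ℝ → ℂ) (x : ℝ) :
    frft θ (fun y => c * f y) x = c * frft θ f x := by
  simp_rw [frft, mul_left_comm _ c, integral_const_mul]

/-- A shift by a multiple of π preserves the cotangent, hence the chirps and the principal root; it
only multiplies the sine, and so the frequency x / sin θ, by cos φ = ±1. -/
lemma frft_add_of_sin_eq_zero (θ : ℝ) {φ : ℝ} (hφ : Real.sin φ = 0) (f : ℝ → ℂ) (x : ℝ) :
    frft (θ + φ) f x = frft θ f (Real.cos φ * x) := by
  have hs : Real.sin (θ + φ) = Real.sin θ * Real.cos φ := by rw [Real.sin_add, hφ]; ring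
  have hc : Real.cos (θ + φ) = Real.cos θ * Real.cos φ := by rw [Real.cos_add, hφ]; ring
  have h2 := sq_cos_eq_one hφ
  have hne : Real.cos φ ≠ 0 := fun h => by simp [h] at h2
  by_cases hθ : Real.sin θ = 0
  · rw [frft_of_sin_eq_zero (by rw [hs, hθ, zero_mul]), frft_of_sin_eq_zero hθ, hc, mul_assoc]
  · have hs' : Real.sin (θ + φ) ≠ 0 := by
      rw [hs]
      exact mul_ne_zero hθ hne
    have hcot : Real.cot (θ + φ) = Real.cot θ := by
      rw [Real.cot_eq_cos_div_sin, Real.cot_eq_cos_div_sin, hs, hc, mul_div_mul_right _ _ hne]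
    rw [frft_of_sin_ne_zero hs', frft_of_sin_ne_zero hθ]
    have hx : x / Real.sin (θ + φ) = Real.cos φ * x / Real.sin θ := by
      rw [hs]
      field_simp
      linear_combination -x * h2
    have hx2 : (Real.cos φ * x) ^ 2 = x ^ 2 := by linear_combination x ^ 2 * h2
    rw [hcot, hx, hx2, frftConst, frftConst, hcot]

/-- Fourier inversion at frequency scale κ. It replaces the Gaussian Parseval identity in the
degenerate case σ = 0. -/
lemma integral_phase_mul_integral_phase_neg {F : ℝ → ℂ} (hFc : Continuous F) (hF : Integrable F)
    {κ : ℝ} (hκ : κ ≠ 0) (hG : Integrable fun x => ∫ y, phase (κ * x * y) * F y) (w : ℝ) :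
    ∫ x, phase (κ * w * x) * ∫ y, phase (κ * x * y) * F y
      = (2 * Real.pi / |κ| : ℝ) * F (-w) := by
  have hp := Real.pi_pos
  have hfour : ∀ ξ : ℝ, ∫ y, phase (κ * ξ * y) * F y = FourierTransform.fourier F (-(κ / (2 * Real.pi)) * ξ) := by
    intro ξ
    rw [Real.fourier_real_eq_integral_exp_smul]
    congr 1 with y
    rw [phase, smul_eq_mul]
    congr 2
    push_cast
    have : (Real.pi : ℂ) ≠ 0 := by exact_mod_cast hp.ne'
    field_simp
  have hne : -(κ / (2 * Real.pi)) ≠ 0 := by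
    rw [neg_ne_zero]
    positivity
  have hGi : Integrable (FourierTransform.fourier F) := by
    simp_rw [hfour] at hG
    exact (integrable_comp_mul_left_iff _ hne).1 hG
  have hinv := congrFun (hFc.fourierInv_fourier_eq hF hGi) (-w)
  rw [← hinv, Real.fourierInv_eq']
  simp_rw [hfour]
  have hcv := Measure.integral_comp_mul_left
    (fun t => phase (2 * Real.pi * -w * t) * FourierTransform.fourier F t) (-(κ / (2 * Real.pi)))
  have habs : |(-(κ / (2 * Real.pi)))⁻¹| = 2 * Real.pi / |κ| := by
    rw [abs_inv, abs_neg, abs_div, abs_of_pos (by positivity : (0 : ℝ) < 2 * Real.pi), inv_div]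
  rw [habs] at hcv
  convert! hcv using 2
  · ext x
    congr 2
    field_simp
  · refine integral_congr_ae (Eventually.of_forall fun t => ?_)
    simp only
    rw [phase, smul_eq_mul]
    congr 2
    simp
    ring

/-- **Additivity of the fractional Fourier transform.** -/
theorem frft_frft (θ φ : ℝ) {f : ℝ → ℂ} (hc : Continuous f) (hf : Integrable f)
    (hg : Integrable (frft θ f)) (z : ℝ) : frft φ (frft θ f) z = frft (θ + φ) f z := by
  by_cases hφ : Real.sin φ = 0
  · rw [frft_of_sin_eq_zero hφ, frft_add_of_sin_eq_zero θ hφ]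
  by_cases hθ : Real.sin θ = 0
  · rw [add_comm, frft_add_of_sin_eq_zero φ hθ, funext (frft_of_sin_eq_zero hθ f)]
    rcases cos_eq_one_or_neg_one hθ with h | h
    · simp [h]
    · simp [h, frft_neg]
  set F : ℝ → ℂ := fun y => phase (-(Real.cot θ / 2) * y ^ 2) * f y with hFdef
  have hFc : Continuous F := by fun_prop
  have hF : Integrable F := integrable_phase_mul hf (by fun_prop)
  have hA : frftConst θ ≠ 0 := by
    intro h
    have := norm_frftConst_sq hθ
    rw [h] at this
    have hp := Real.pi_pos
    have hs : 0 < |Real.sin θ| := abs_pos.2 hθ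
    have : 0 < 1 / (2 * Real.pi * |Real.sin θ|) := by positivity
    simp_all
  have hG : Integrable fun x => ∫ y, phase ((Real.sin θ)⁻¹ * x * y) * F y := by
    have := (integrable_phase_mul (q := fun x => Real.cot θ / 2 * x ^ 2) hg (by fun_prop)).const_mul
      (frftConst θ)⁻¹
    refine this.congr (Eventually.of_forall fun x => ?_)
    simp only
    rw [frft_of_sin_ne_zero hθ]
    have h1 := phase_mul_phase_neg (Real.cot θ / 2 * x ^ 2)
    have h2 : ∀ J : ℂ, (frftConst θ)⁻¹ * (phase (Real.cot θ / 2 * x ^ 2)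
        * (frftConst θ * phase (-(Real.cot θ / 2) * x ^ 2) * J)) = J := by
      intro J
      rw [neg_mul]
      linear_combination (J * phase (Real.cot θ / 2 * x ^ 2) * phase (-(Real.cot θ / 2 * x ^ 2)))
        * inv_mul_cancel₀ hA + J * h1
    rw [h2]
    simp_rw [div_eq_inv_mul x]
    rfl
  -- The outer chirp of the first transform and the inner chirp of the second merge into one
  -- Gaussian in x, with coefficient cot θ + cot φ; it vanishes exactly when sin(θ + φ) = 0.
  have hl : frft φ (frft θ f) z = frftConst φ * frftConst θ * phase (-(Real.cot φ / 2) * z ^ 2)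
      * ∫ x, phase (-((Real.cot θ + Real.cot φ) / 2) * x ^ 2 + z / Real.sin φ * x)
        * ∫ y, phase ((Real.sin θ)⁻¹ * x * y) * F y := by
    have e : ∫ x, phase (z / Real.sin φ * x) * (phase (-(Real.cot φ / 2) * x ^ 2) * frft θ f x)
        = frftConst θ * ∫ x, phase (-((Real.cot θ + Real.cot φ) / 2) * x ^ 2 + z / Real.sin φ * x)
          * ∫ y, phase ((Real.sin θ)⁻¹ * x * y) * F y := by
      rw [← integral_const_mul]
      refine integral_congr_ae (Eventually.of_forall fun x => ?_)
      simp only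
      rw [frft_of_sin_ne_zero hθ, phase_add]
      have : -((Real.cot θ + Real.cot φ) / 2) * x ^ 2
        = -(Real.cot θ / 2) * x ^ 2 + -(Real.cot φ / 2) * x ^ 2 := by ring
      rw [this, phase_add]
      simp_rw [div_eq_inv_mul x, hFdef]
      ring
    rw [frft_of_sin_ne_zero hφ, e]
    ring
  by_cases h : Real.sin (θ + φ) = 0
  · have hσ : Real.cot θ + Real.cot φ = 0 := by rw [cot_add_cot hθ hφ, h, zero_div]
    have hc1 := sq_cos_eq_one h
    have hs : Real.sin φ = -(Real.cos (θ + φ) * Real.sin θ) := by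
      have : Real.sin φ = Real.sin (θ + φ - θ) := by ring_nf
      rw [this, Real.sin_sub, h]
      ring
    have hcne : Real.cos (θ + φ) ≠ 0 := fun h => by simp [h] at hc1
    rw [hl, hσ, frft_of_sin_eq_zero h]
    -- Inversion returns the value at -w, and the expected result is f at cos(θ + φ) z; this
    -- dictates w.
    have := integral_phase_mul_integral_phase_neg hFc hF (inv_ne_zero hθ) hG (-(Real.cos (θ + φ) * z))
    have h3 : ∀ x, -((0 : ℝ) / 2) * x ^ 2 + z / Real.sin φ * x
        = (Real.sin θ)⁻¹ * (-(Real.cos (θ + φ) * z)) * x := by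
      intro x
      rw [hs]
      field_simp
      linear_combination (2 * x * z) * hc1
    simp_rw [h3, this, neg_neg, hFdef]
    have h4 := frftConst_mul_of_sin_add_eq_zero hθ hφ h
    have h5 : -(Real.cot θ / 2) * (Real.cos (θ + φ) * z) ^ 2 = Real.cot φ / 2 * z ^ 2 := by
      linear_combination (-(z ^ 2) / 2) * hσ - (Real.cot θ / 2 * z ^ 2) * hc1
    rw [h5, abs_inv, div_inv_eq_mul, neg_mul]
    have h6 := phase_mul_phase_neg (Real.cot φ / 2 * z ^ 2)
    linear_combination (f (Real.cos (θ + φ) * z)) * h4 + (f (Real.cos (θ + φ) * z)) *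
      (frftConst θ * frftConst φ * (2 * Real.pi * |Real.sin θ| : ℝ)) * h6
  · have hσ : Real.cot θ + Real.cot φ ≠ 0 := by
      rw [cot_add_cot hθ hφ]
      exact div_ne_zero h (mul_ne_zero hθ hφ)
    rw [hl, integral_phase_mul_integral_phase hF _ hG hσ, frft_of_sin_ne_zero h,
      ← frftConst_mul hθ hφ h]
    have key : ∀ y, phase (-(Real.cot φ / 2) * z ^ 2)
        * (phase ((z / Real.sin φ + (Real.sin θ)⁻¹ * y) ^ 2 / (2 * (Real.cot θ + Real.cot φ))) * F y)
        = phase (-(Real.cot (θ + φ) / 2) * z ^ 2)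
          * (phase (z / Real.sin (θ + φ) * y) * (phase (-(Real.cot (θ + φ) / 2) * y ^ 2) * f y)) := by
      intro y
      rw [hFdef]
      simp only
      rw [← mul_assoc, ← mul_assoc, ← mul_assoc, ← mul_assoc, ← phase_add, ← phase_add,
        ← phase_add, ← phase_add]
      congr 2
      rw [cot_add_cot hθ hφ, Real.cot_eq_cos_div_sin, Real.cot_eq_cos_div_sin,
        Real.cot_eq_cos_div_sin]
      field_simp
      -- The coefficients of z² and y² in the completed square match by the subtraction formulas for
      -- θ = (θ + φ) - φ and φ = (θ + φ) - θ.
      have e1 : Real.sin θ = Real.cos φ * Real.sin (θ + φ) - Real.sin φ * Real.cos (θ + φ) := by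
        rw [Real.sin_add, Real.cos_add]
        linear_combination (-Real.sin θ) * Real.sin_sq_add_cos_sq φ
      have e2 : Real.sin φ = Real.cos θ * Real.sin (θ + φ) - Real.sin θ * Real.cos (θ + φ) := by
        rw [Real.sin_add, Real.cos_add]
        linear_combination (-Real.sin φ) * Real.sin_sq_add_cos_sq θ
      generalize Real.sin (θ + φ) = S at *
      generalize Real.cos (θ + φ) = C at *
      linear_combination (z ^ 2 * Real.sin θ) * e1 + (y ^ 2 * Real.sin φ) * e2
    have key2 : phase (-(Real.cot φ / 2) * z ^ 2)
        * ∫ y, (phase ((z / Real.sin φ + (Real.sin θ)⁻¹ * y) ^ 2 / (2 * (Real.cot θ + Real.cot φ)))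
          * F y)
        = phase (-(Real.cot (θ + φ) / 2) * z ^ 2)
          * ∫ y, (phase (z / Real.sin (θ + φ) * y)
            * (phase (-(Real.cot (θ + φ) / 2) * y ^ 2) * f y)) := by
      rw [← integral_const_mul, ← integral_const_mul]
      exact integral_congr_ae (Eventually.of_forall key)
    linear_combination (frftConst θ * frftConst φ
      * (2 * Real.pi / (I * ((Real.cot θ + Real.cot φ : ℝ) : ℂ)) : ℂ) ^ (1 / 2 : ℂ)) * key2

/-! ### Stability of Schwartz functions under chirps, substitutions and Fourier integrals. -/

lemma hasDerivAt_phase (t : ℝ) : HasDerivAt phase (I * phase t) t := by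
  have := ((hasDerivAt_id t).ofReal_comp.const_mul I).cexp
  rw [ofReal_one, mul_one, mul_comm] at this
  exact this

lemma iteratedDeriv_phase (n : ℕ) : iteratedDeriv n phase = fun t => I ^ n * phase t := by
  induction n with
  | zero => simp
  | succ n ih =>
    rw [iteratedDeriv_succ, ih]
    ext t
    rw [((hasDerivAt_phase t).const_mul (I ^ n)).deriv]
    ring

-- All derivatives have modulus 1; with composition, this makes chirps multipliers of the Schwartz
-- space.
@[fun_prop]
lemma hasTemperateGrowth_phase : Function.HasTemperateGrowth phase := by
  refine ⟨?_, fun n => ⟨0, 1, fun x => ?_⟩⟩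
  · exact (contDiff_const.mul Complex.ofRealCLM.contDiff).cexp
  · rw [norm_iteratedFDeriv_eq_norm_iteratedDeriv, iteratedDeriv_phase]
    simp [norm_phase]

lemma hasTemperateGrowth_phase_comp {E : Type*} [NormedAddCommGroup E] [NormedSpace ℝ E]
    {q : E → ℝ} (hq : Function.HasTemperateGrowth q) :
    Function.HasTemperateGrowth fun x => phase (q x) :=
  hasTemperateGrowth_phase.comp hq

/-- The functions of the Schwartz space. -/
def IsSchwartz {E : Type*} [NormedAddCommGroup E] [NormedSpace ℝ E] (f : E → ℂ) : Prop :=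
  ∃ F : 𝓢(E, ℂ), ⇑F = f

namespace IsSchwartz

variable {E E' : Type*} [NormedAddCommGroup E] [NormedSpace ℝ E] [NormedAddCommGroup E']
  [NormedSpace ℝ E'] {f : E → ℂ}

protected lemma continuous (hf : IsSchwartz f) : Continuous f := by
  obtain ⟨F, rfl⟩ := hf
  exact F.continuous

protected lemma integrable [MeasurableSpace E] [BorelSpace E] [SecondCountableTopology E]
    (hf : IsSchwartz f) (μ : Measure E) [μ.HasTemperateGrowth] : Integrable f μ := by
  obtain ⟨F, rfl⟩ := hf
  exact F.integrable

lemma mul_left (hf : IsSchwartz f) {g : E → ℂ} (hg : g.HasTemperateGrowth) :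
    IsSchwartz fun x => g x * f x := by
  obtain ⟨F, rfl⟩ := hf
  exact ⟨SchwartzMap.smulLeftCLM ℂ g F, by simp [SchwartzMap.smulLeftCLM_apply hg]⟩

lemma const_mul (hf : IsSchwartz f) (c : ℂ) : IsSchwartz fun x => c * f x :=
  hf.mul_left (.const c)

lemma comp_equiv (hf : IsSchwartz f) (e : E' ≃L[ℝ] E) : IsSchwartz fun x => f (e x) := by
  obtain ⟨F, rfl⟩ := hf
  exact ⟨SchwartzMap.compCLMOfContinuousLinearEquiv ℂ e F, rfl⟩

lemma comp_antilipschitz (hf : IsSchwartz f) {g : E' → E} (hg : g.HasTemperateGrowth)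
    {K : NNReal} (hK : AntilipschitzWith K g) : IsSchwartz fun x => f (g x) := by
  obtain ⟨F, rfl⟩ := hf
  exact ⟨SchwartzMap.compCLMOfAntilipschitz ℂ hg hK F, rfl⟩

end IsSchwartz

lemma hasTemperateGrowth_prodMk {E F G : Type*} [NormedAddCommGroup E] [NormedSpace ℝ E]
    [NormedAddCommGroup F] [NormedSpace ℝ F] [NormedAddCommGroup G] [NormedSpace ℝ G]
    {f : E → F} {g : E → G} (hf : f.HasTemperateGrowth) (hg : g.HasTemperateGrowth) :
    Function.HasTemperateGrowth fun x => (f x, g x) := by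
  have h := ((ContinuousLinearMap.inl ℝ F G).hasTemperateGrowth.comp hf).add
    ((ContinuousLinearMap.inr ℝ F G).hasTemperateGrowth.comp hg)
  convert! h using 1
  ext x <;> simp

@[fun_prop]
lemma hasTemperateGrowth_fst {F G : Type*} [NormedAddCommGroup F] [NormedSpace ℝ F]
    [NormedAddCommGroup G] [NormedSpace ℝ G] :
    Function.HasTemperateGrowth fun x : F × G => x.1 :=
  (ContinuousLinearMap.fst ℝ F G).hasTemperateGrowth

@[fun_prop]
lemma hasTemperateGrowth_snd {F G : Type*} [NormedAddCommGroup F] [NormedSpace ℝ F]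
    [NormedAddCommGroup G] [NormedSpace ℝ G] :
    Function.HasTemperateGrowth fun x : F × G => x.2 :=
  (ContinuousLinearMap.snd ℝ F G).hasTemperateGrowth

namespace IsSchwartz

variable {H : ℝ × ℝ → ℂ}

lemma slice_left (hH : IsSchwartz H) (y : ℝ) : IsSchwartz fun s => H (s, y) := by
  refine hH.comp_antilipschitz (K := 1) (hasTemperateGrowth_prodMk .id' (.const y)) ?_
  refine AntilipschitzWith.of_le_mul_dist fun s t => ?_
  simp [Prod.dist_eq]

lemma slice_right (hH : IsSchwartz H) (x : ℝ) : IsSchwartz fun t => H (x, t) := by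
  refine hH.comp_antilipschitz (K := 1) (hasTemperateGrowth_prodMk (.const x) .id') ?_
  refine AntilipschitzWith.of_le_mul_dist fun s t => ?_
  simp [Prod.dist_eq]

lemma comp_swap (hH : IsSchwartz H) : IsSchwartz fun p : ℝ × ℝ => H (p.2, p.1) :=
  hH.comp_equiv (ContinuousLinearEquiv.prodComm ℝ ℝ ℝ)

/-- Scaling of one variable. -/
def scaling {a : ℝ} (ha : a ≠ 0) : ℝ ≃L[ℝ] ℝ :=
  ContinuousLinearEquiv.unitsEquivAut ℝ (Units.mk0 a ha)

lemma scaling_apply {a : ℝ} (ha : a ≠ 0) (x : ℝ) : scaling ha x = a * x := by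
  simp [scaling, mul_comm]

lemma comp_mul {f : ℝ → ℂ} (hf : IsSchwartz f) {a : ℝ} (ha : a ≠ 0) :
    IsSchwartz fun x => f (a * x) := by
  simpa only [scaling_apply] using hf.comp_equiv (scaling ha)

lemma comp_mul_prod (hH : IsSchwartz H) {a b : ℝ} (ha : a ≠ 0) (hb : b ≠ 0) :
    IsSchwartz fun p : ℝ × ℝ => H (a * p.1, b * p.2) := by
  have := hH.comp_equiv ((scaling ha).prodCongr (scaling hb))
  simpa only [ContinuousLinearEquiv.prodCongr_apply, scaling_apply] using this

lemma integral_phase {f : ℝ → ℂ} (hf : IsSchwartz f) {κ : ℝ} (hκ : κ ≠ 0) :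
    IsSchwartz fun x => ∫ y, phase (κ * x * y) * f y := by
  have hp := Real.pi_pos
  obtain ⟨F, rfl⟩ := hf
  have h1 : IsSchwartz (FourierTransform.fourier (F : ℝ → ℂ)) :=
    ⟨FourierTransform.fourier F, SchwartzMap.fourier_coe F⟩
  have h2 := h1.comp_mul (a := -(κ / (2 * Real.pi))) (neg_ne_zero.2 (by positivity))
  convert! h2 using 2 with x
  rw [Real.fourier_real_eq_integral_exp_smul]
  refine integral_congr_ae (Eventually.of_forall fun y => ?_)
  simp only
  rw [phase, smul_eq_mul]
  congr 2
  push_cast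
  have : (Real.pi : ℂ) ≠ 0 := by exact_mod_cast hp.ne'
  field_simp

/-- The product ℝ × ℝ carries the sup norm, so the two-dimensional Fourier transform is taken on ℂ,
whose real inner product is the Euclidean one, and then rescaled in each coordinate. -/
lemma integral_phase_prod (hH : IsSchwartz H) {a b : ℝ} (ha : a ≠ 0) (hb : b ≠ 0) :
    IsSchwartz fun p : ℝ × ℝ => ∫ q : ℝ × ℝ, phase (a * p.1 * q.1 + b * p.2 * q.2) * H q := by
  have hp := Real.pi_pos
  obtain ⟨F, hF⟩ := hH.comp_equiv Complex.equivRealProdCLM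
  have h1 : IsSchwartz (FourierTransform.fourier (F : ℂ → ℂ)) :=
    ⟨FourierTransform.fourier F, SchwartzMap.fourier_coe F⟩
  have h2 := (h1.comp_equiv Complex.equivRealProdCLM.symm).comp_mul_prod
    (a := -(a / (2 * Real.pi))) (b := -(b / (2 * Real.pi)))
    (neg_ne_zero.2 (by positivity)) (neg_ne_zero.2 (by positivity))
  convert! h2 using 2 with p
  rw [hF, Real.fourier_eq',
    ← Complex.volume_preserving_equiv_real_prod.integral_comp
      Complex.measurableEquivRealProd.measurableEmbedding]
  refine integral_congr_ae (Eventually.of_forall fun z => ?_)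
  simp only
  rw [phase, smul_eq_mul]
  congr 2
  rw [Complex.inner, mul_comm]
  congr 2
  simp
  field_simp
  ring

end IsSchwartz

/-- The fractional Fourier transform of a Schwartz function is a Schwartz function. -/
lemma IsSchwartz.isSchwartz_frft {f : ℝ → ℂ} (hf : IsSchwartz f) (θ : ℝ) : IsSchwartz (frft θ f) := by
  by_cases hθ : Real.sin θ = 0
  · rw [funext (frft_of_sin_eq_zero hθ f)]
    refine hf.comp_mul fun h => ?_
    have := sq_cos_eq_one hθ
    simp [h] at this
  · rw [funext (frft_of_sin_ne_zero hθ f)]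
    have h1 := hf.mul_left (g := fun y => phase (-(Real.cot θ / 2) * y ^ 2))
      (hasTemperateGrowth_phase_comp (by fun_prop))
    have h2 := (h1.integral_phase (inv_ne_zero hθ)).mul_left
      (g := fun x => frftConst θ * phase (-(Real.cot θ / 2) * x ^ 2))
      (.mul (.const _) (hasTemperateGrowth_phase_comp (by fun_prop)))
    simpa only [div_eq_inv_mul] using h2

/-! ### Partial fractional Fourier transforms on the plane. -/

/-- The partial fractional Fourier transform in the first variable. -/
def frftFst (θ : ℝ) (H : ℝ × ℝ → ℂ) (p : ℝ × ℝ) : ℂ := frft θ (fun s => H (s, p.2)) p.1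

/-- The partial fractional Fourier transform in the second variable. -/
def frftSnd (φ : ℝ) (H : ℝ × ℝ → ℂ) (p : ℝ × ℝ) : ℂ := frft φ (fun t => H (p.1, t)) p.2

lemma IsSchwartz.integrable_prod_kernelMeasure {H : ℝ × ℝ → ℂ} (hH : IsSchwartz H)
    (θ φ x y : ℝ) : Integrable H ((kernelMeasure x θ).prod (kernelMeasure y φ)) := by
  have hm := hH.continuous.aestronglyMeasurable (μ := (kernelMeasure x θ).prod (kernelMeasure y φ))
  by_cases hθ : Real.sin θ = 0
  · rw [kernelMeasure_of_sin_eq_zero hθ] at *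
    rw [Measure.dirac_prod] at *
    rw [integrable_map_measure hm (by fun_prop)]
    by_cases hφ : Real.sin φ = 0
    · rw [kernelMeasure_of_sin_eq_zero hφ]
      exact integrable_dirac (by simp)
    · rw [kernelMeasure_of_sin_ne_zero hφ]
      exact (hH.slice_right _).integrable _
  · rw [kernelMeasure_of_sin_ne_zero hθ] at *
    by_cases hφ : Real.sin φ = 0
    · rw [kernelMeasure_of_sin_eq_zero hφ] at *
      rw [Measure.prod_dirac] at *
      rw [integrable_map_measure hm (by fun_prop)]
      exact (hH.slice_left _).integrable _
    · rw [kernelMeasure_of_sin_ne_zero hφ]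
      exact hH.integrable _

lemma IsSchwartz.integrable_kernelDensity_mul {H : ℝ × ℝ → ℂ} (hH : IsSchwartz H)
    (θ φ x y : ℝ) :
    Integrable (fun p : ℝ × ℝ => kernelDensity x p.1 θ * kernelDensity y p.2 φ * H p)
      ((kernelMeasure x θ).prod (kernelMeasure y φ)) := by
  refine (hH.integrable_prod_kernelMeasure θ φ x y).bdd_mul
    (c := ‖kernelDensity 0 0 θ‖ * ‖kernelDensity 0 0 φ‖) (by fun_prop) ?_
  refine Eventually.of_forall fun p => ?_
  rw [norm_mul, norm_kernelDensity x, norm_kernelDensity y]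

/-- Fubini. It turns the double integrals of `HasKernelIntegral` into iterated transforms, to which
additivity applies. -/
lemma IsSchwartz.integral_kernelDensity_mul {H : ℝ × ℝ → ℂ} (hH : IsSchwartz H) (θ φ x y : ℝ) :
    ∫ p : ℝ × ℝ, kernelDensity x p.1 θ * kernelDensity y p.2 φ * H p
      ∂((kernelMeasure x θ).prod (kernelMeasure y φ)) = frftFst θ (frftSnd φ H) (x, y) := by
  rw [integral_prod _ (hH.integrable_kernelDensity_mul θ φ x y), frftFst, frft]
  refine integral_congr_ae (Eventually.of_forall fun s => ?_)
  simp only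
  rw [frftSnd, frft, ← integral_const_mul]
  simp_rw [mul_assoc]

lemma IsSchwartz.frftFst_frftSnd_comm {H : ℝ × ℝ → ℂ} (hH : IsSchwartz H) (θ φ : ℝ) :
    frftFst θ (frftSnd φ H) = frftSnd φ (frftFst θ H) := by
  ext ⟨x, y⟩
  rw [← hH.integral_kernelDensity_mul,
    integral_prod_symm _ (hH.integrable_kernelDensity_mul θ φ x y), frftSnd, frft]
  refine integral_congr_ae (Eventually.of_forall fun s => ?_)
  simp only
  rw [frftFst, frft, ← integral_const_mul]
  congr 1
  ext t
  ring

/-- Both angles generic. -/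
lemma IsSchwartz.frftFst_frftSnd_of_sin_ne_zero {H : ℝ × ℝ → ℂ} (hH : IsSchwartz H) {θ φ : ℝ}
    (hθ : Real.sin θ ≠ 0) (hφ : Real.sin φ ≠ 0) : IsSchwartz (frftFst θ (frftSnd φ H)) := by
  have h1 := hH.mul_left (g := fun p => phase (-(Real.cot θ / 2) * p.1 ^ 2)
      * phase (-(Real.cot φ / 2) * p.2 ^ 2))
    (.mul (hasTemperateGrowth_phase_comp (by fun_prop))
      (hasTemperateGrowth_phase_comp (by fun_prop)))
  have h2 := (h1.integral_phase_prod (inv_ne_zero hθ) (inv_ne_zero hφ)).mul_left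
    (g := fun p => frftConst θ * frftConst φ * (phase (-(Real.cot θ / 2) * p.1 ^ 2)
      * phase (-(Real.cot φ / 2) * p.2 ^ 2)))
    (.mul (.const _) (.mul (hasTemperateGrowth_phase_comp (by fun_prop))
      (hasTemperateGrowth_phase_comp (by fun_prop))))
  convert! h2 using 1
  ext ⟨x, y⟩
  rw [← hH.integral_kernelDensity_mul, kernelMeasure_of_sin_ne_zero hθ,
    kernelMeasure_of_sin_ne_zero hφ, ← integral_const_mul]
  refine integral_congr_ae (Eventually.of_forall fun s => ?_)
  simp only
  rw [kernelDensity_of_sin_ne_zero hθ, kernelDensity_of_sin_ne_zero hφ, phase_add, div_eq_inv_mul x,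
    div_eq_inv_mul y]
  ring

/-- A majorant C/(1 + s²) uniform in t, for continuity in t of integrals over s. -/
lemma IsSchwartz.exists_norm_slice_le {H : ℝ × ℝ → ℂ} (hH : IsSchwartz H) :
    ∃ b : ℝ → ℝ, Integrable b ∧ ∀ s t, ‖H (s, t)‖ ≤ b s := by
  obtain ⟨F, rfl⟩ := hH
  obtain ⟨C, -, hC⟩ := F.decay 2 0
  obtain ⟨C', -, hC'⟩ := F.decay 0 0
  refine ⟨fun s => (C + C') * (1 + s ^ 2)⁻¹, integrable_inv_one_add_sq.const_mul _, fun s t => ?_⟩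
  have h1 := hC (s, t)
  have h2 := hC' (s, t)
  simp only [norm_iteratedFDeriv_zero, pow_zero, one_mul] at h1 h2
  have h3 : s ^ 2 ≤ ‖(s, t)‖ ^ 2 := by
    rw [← sq_abs s]
    exact pow_le_pow_left₀ (abs_nonneg s) (norm_fst_le (s, t)) 2
  simp only
  rw [← div_eq_mul_inv, le_div_iff₀ (by positivity)]
  have := mul_le_mul_of_nonneg_right h3 (norm_nonneg (F (s, t)))
  nlinarith

/-- A partial fractional Fourier transform of a Schwartz function is a Schwartz function. It is the
product of two full transforms. -/
lemma IsSchwartz.isSchwartz_frftFst {H : ℝ × ℝ → ℂ} (hH : IsSchwartz H) (θ : ℝ) :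
    IsSchwartz (frftFst θ H) := by
  by_cases hθ : Real.sin θ = 0
  · have h : frftFst θ H = fun p => H (Real.cos θ * p.1, 1 * p.2) := by
      ext p
      rw [frftFst, frft_of_sin_eq_zero hθ, one_mul]
    rw [h]
    refine hH.comp_mul_prod (fun h => ?_) one_ne_zero
    have := sq_cos_eq_one hθ
    simp [h] at this
  -- The angles (θ, 0) are split as (θ/2, -π/2) + (θ/2, π/2). All four are generic, so the
  -- two-variable result applies twice, and the quarter turns in the second variable cancel.
  have hθ2 : Real.sin (θ / 2) ≠ 0 := by
    intro h
    apply hθ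
    rw [← add_halves θ, Real.sin_add, h]
    ring
  have hp : Real.sin (Real.pi / 2) ≠ 0 := by simp
  have hm : Real.sin (-(Real.pi / 2)) ≠ 0 := by simp
  set E := frftFst (θ / 2) (frftSnd (-(Real.pi / 2)) H) with hEdef
  have hE : IsSchwartz E := hH.frftFst_frftSnd_of_sin_ne_zero hθ2 hm
  have hEcomm : E = frftSnd (-(Real.pi / 2)) (frftFst (θ / 2) H) :=
    hH.frftFst_frftSnd_comm _ _
  convert! hE.frftFst_frftSnd_of_sin_ne_zero hθ2 hp using 1
  set K := frftFst (θ / 2) H with hKdef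
  -- That `K` is a Schwartz function is not yet available; for the cancellation, `frft_frft` needs
  -- only continuous integrable slices, besides an integrable transform, which `E` provides.
  have hKc : ∀ s, Continuous fun t => K (s, t) := by
    intro s
    obtain ⟨b, hb, hHb⟩ := hH.exists_norm_slice_le
    simp only [hKdef, frftFst, frft]
    refine continuous_of_dominated (bound := fun u => ‖kernelDensity 0 0 (θ / 2)‖ * b u) ?_ ?_ ?_ ?_
    · intro t
      exact (Continuous.mul (by fun_prop) (hH.slice_left t).continuous).aestronglyMeasurable
    · refine fun t => Eventually.of_forall fun u => ?_
      rw [norm_mul, norm_kernelDensity]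
      exact mul_le_mul_of_nonneg_left (hHb u t) (norm_nonneg _)
    · rw [kernelMeasure_of_sin_ne_zero hθ2]
      exact hb.const_mul _
    · refine Eventually.of_forall fun u => ?_
      exact continuous_const.mul (hH.slice_right u).continuous
  have hKi : ∀ s, Integrable fun t => K (s, t) := by
    intro s
    have h1 : Integrable (fun p : ℝ × ℝ => kernelDensity s p.1 (θ / 2) * H p)
        (volume.prod volume) := by
      refine (hH.integrable _).bdd_mul (c := ‖kernelDensity 0 0 (θ / 2)‖) (by fun_prop) ?_
      exact Eventually.of_forall fun p => (norm_kernelDensity _ _ _).le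
    have h2 := h1.integral_prod_right
    simpa only [hKdef, frftFst, frft, kernelMeasure_of_sin_ne_zero hθ2] using h2
  have h1 : frftSnd (Real.pi / 2) E = K := by
    ext ⟨s, t⟩
    have hEs : (fun t => E (s, t)) = frft (-(Real.pi / 2)) fun t => K (s, t) := by
      rw [hEcomm]
      rfl
    rw [frftSnd]
    simp only
    rw [hEs, frft_frft _ _ (hKc s) (hKi s), neg_add_cancel, frft_of_sin_eq_zero Real.sin_zero]
    · simp
    · rw [← hEs]
      exact (hE.slice_right s).integrable _
  rw [h1]
  ext ⟨x, y⟩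
  have h2 := hH.slice_left y
  change frft θ _ x = frft (θ / 2) (frft (θ / 2) fun s => H (s, y)) x
  rw [frft_frft _ _ h2.continuous (h2.integrable _) ((h2.isSchwartz_frft _).integrable _), add_halves]

lemma IsSchwartz.isSchwartz_frftSnd {H : ℝ × ℝ → ℂ} (hH : IsSchwartz H) (φ : ℝ) :
    IsSchwartz (frftSnd φ H) :=
  (hH.comp_swap.isSchwartz_frftFst φ).comp_swap

lemma IsSchwartz.frftFst_frftFst {H : ℝ × ℝ → ℂ} (hH : IsSchwartz H) (θ φ : ℝ) :
    frftFst φ (frftFst θ H) = frftFst (θ + φ) H := by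
  ext ⟨x, y⟩
  have h2 := hH.slice_left y
  exact frft_frft θ φ h2.continuous (h2.integrable _) ((h2.isSchwartz_frft _).integrable _) x

lemma IsSchwartz.frftSnd_frftSnd {H : ℝ × ℝ → ℂ} (hH : IsSchwartz H) (θ φ : ℝ) :
    frftSnd φ (frftSnd θ H) = frftSnd (θ + φ) H := by
  ext ⟨x, y⟩
  have h2 := hH.slice_right x
  exact frft_frft θ φ h2.continuous (h2.integrable _) ((h2.isSchwartz_frft _).integrable _) y

/-! ### Unitary operators defined by formulas on Schwartz functions. -/

/-- `S` maps Schwartz functions to Schwartz functions, and extends to a unitary operator of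
`L²(ℝ)`. -/
def ExtendsToUnitary (S : (ℝ → ℂ) → ℝ → ℂ) : Prop :=
  ∃ V ∈ unitary Op, ∀ g : 𝓢(ℝ, ℂ), ∃ g' : 𝓢(ℝ, ℂ), ⇑g' = S g ∧ V (g.toLp 2 volume) = g'.toLp 2 volume

namespace ExtendsToUnitary

lemma comp {S S' : (ℝ → ℂ) → ℝ → ℂ} (hS' : ExtendsToUnitary S') (hS : ExtendsToUnitary S) :
    ExtendsToUnitary fun g => S' (S g) := by
  obtain ⟨V, hV, h⟩ := hS
  obtain ⟨V', hV', h'⟩ := hS'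
  refine ⟨V' * V, mul_mem hV' hV, fun g => ?_⟩
  obtain ⟨g', hg', hVg⟩ := h g
  obtain ⟨g'', hg'', hVg'⟩ := h' g'
  exact ⟨g'', by rw [hg'', hg'], by rw [mul_apply_eq_comp, hVg, hVg']⟩

/-- An isometric bijection of a dense subspace extends by continuity to a surjective isometry;
surjectivity is why an equivalence is asked for. -/
lemma of_linearEquiv (e : 𝓢(ℝ, ℂ) ≃ₗ[ℂ] 𝓢(ℝ, ℂ))
    (he : ∀ g, ‖(e g).toLp 2 volume‖ = ‖g.toLp 2 volume‖) {S : (ℝ → ℂ) → ℝ → ℂ}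
    (hS : ∀ g, ⇑(e g) = S g) : ExtendsToUnitary S := by
  have hd : DenseRange (SchwartzMap.toLpCLM ℂ (E := ℝ) ℂ 2 (volume : Measure ℝ)) :=
    SchwartzMap.denseRange_toLpCLM ENNReal.ofNat_ne_top
  let V : Hilb ≃ₗᵢ[ℂ] Hilb := e.extendOfIsometry (SchwartzMap.toLpCLM ℂ (E := ℝ) ℂ 2 volume)
    (SchwartzMap.toLpCLM ℂ (E := ℝ) ℂ 2 volume) hd hd he
  refine ⟨(Unitary.linearIsometryEquiv.symm V : unitary Op), SetLike.coe_mem _, fun g => ?_⟩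
  refine ⟨e g, hS g, ?_⟩
  exact e.extendOfIsometry_eq _ _ hd hd he g

lemma const_mul_phase_mul {q : ℝ → ℝ} (hq : q.HasTemperateGrowth) {ζ : ℂ} (hζ : ‖ζ‖ = 1) :
    ExtendsToUnitary fun g x => ζ * phase (q x) * g x := by
  have hζ0 : ζ ≠ 0 := fun h => by simp [h] at hζ
  have h1 : Function.HasTemperateGrowth fun x => ζ * phase (q x) :=
    .mul (.const _) (hasTemperateGrowth_phase_comp hq)
  have h2 : Function.HasTemperateGrowth fun x => ζ⁻¹ * phase (-q x) :=
    .mul (.const _) (hasTemperateGrowth_phase_comp hq.neg)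
  have h3 : ∀ x, (ζ * phase (q x)) * (ζ⁻¹ * phase (-q x)) = 1 := by
    intro x
    rw [mul_mul_mul_comm, mul_inv_cancel₀ hζ0, phase_mul_phase_neg, one_mul]
  let e : 𝓢(ℝ, ℂ) ≃ₗ[ℂ] 𝓢(ℝ, ℂ) := LinearEquiv.ofLinearMap
    (SchwartzMap.smulLeftCLM ℂ fun x => ζ * phase (q x)).toLinearMap
    (SchwartzMap.smulLeftCLM ℂ fun x => ζ⁻¹ * phase (-q x)).toLinearMap
    (by
      ext g x
      simp only [LinearMap.comp_apply, ContinuousLinearMap.coe_coe, LinearMap.id_apply]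
      rw [SchwartzMap.smulLeftCLM_apply_apply h1, SchwartzMap.smulLeftCLM_apply_apply h2,
        smul_smul, h3, one_smul])
    (by
      ext g x
      simp only [LinearMap.comp_apply, ContinuousLinearMap.coe_coe, LinearMap.id_apply]
      rw [SchwartzMap.smulLeftCLM_apply_apply h2, SchwartzMap.smulLeftCLM_apply_apply h1,
        smul_smul, mul_comm, h3, one_smul])
  have he : ∀ (g : 𝓢(ℝ, ℂ)) x, e g x = ζ * phase (q x) * g x := fun g x =>
    SchwartzMap.smulLeftCLM_apply_apply h1 g x
  refine of_linearEquiv e (fun g => ?_) (fun g => funext (he g))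
  rw [SchwartzMap.norm_toLp, SchwartzMap.norm_toLp]
  congr 1
  refine eLpNorm_congr_norm_ae (Eventually.of_forall fun x => ?_)
  rw [he, norm_mul, norm_mul, hζ, norm_phase, one_mul, one_mul]

lemma comp_affine {a : ℝ} (ha : a ≠ 0) (b : ℝ) :
    ExtendsToUnitary fun g x => (√|a| : ℝ) * g (a * x + b) := by
  have hs : 0 < √|a| := Real.sqrt_pos.2 (abs_pos.2 ha)
  have hs0 : ((√|a| : ℝ) : ℂ) ≠ 0 := by exact_mod_cast hs.ne'
  let lin : ℝ → (𝓢(ℝ, ℂ) →L[ℂ] 𝓢(ℝ, ℂ)) := fun b => SchwartzMap.compSubConstCLM ℂ (-b)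
  let dil {a : ℝ} (ha : a ≠ 0) : 𝓢(ℝ, ℂ) →L[ℂ] 𝓢(ℝ, ℂ) :=
    SchwartzMap.compCLMOfContinuousLinearEquiv ℂ (IsSchwartz.scaling ha)
  have hlin : ∀ b (g : 𝓢(ℝ, ℂ)) x, lin b g x = g (x + b) := fun b g x => by
    simp [lin]
  have hdil : ∀ {a : ℝ} (ha : a ≠ 0) (g : 𝓢(ℝ, ℂ)) x, dil ha g x = g (a * x) := fun ha g x => by
    simp [dil, IsSchwartz.scaling_apply]
  let e : 𝓢(ℝ, ℂ) ≃ₗ[ℂ] 𝓢(ℝ, ℂ) := LinearEquiv.ofLinearMap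
    (((√|a| : ℝ) : ℂ) • (dil ha ∘L lin b)).toLinearMap
    ((((√|a| : ℝ) : ℂ)⁻¹) • (lin (-b) ∘L dil (inv_ne_zero ha))).toLinearMap
    (by
      ext g x
      simp [hlin, hdil, hs0, ha])
    (by
      ext g x
      simp [hlin, hdil, hs0, ha])
  have he : ∀ (g : 𝓢(ℝ, ℂ)) x, e g x = (√|a| : ℝ) * g (a * x + b) := fun g x => by
    simp [e, hlin, hdil]
  refine of_linearEquiv e (fun g => ?_) (fun g => funext (he g))
  rw [SchwartzMap.norm_toLp' two_ne_zero ENNReal.ofNat_ne_top,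
    SchwartzMap.norm_toLp' two_ne_zero ENNReal.ofNat_ne_top]
  congr 1
  have h1 : ∀ x, ‖e g x‖ ^ (2 : ENNReal).toReal
      = |a| * ‖g (a * x + b)‖ ^ (2 : ENNReal).toReal := by
    intro x
    rw [he, norm_mul, norm_real, Real.norm_of_nonneg hs.le, ENNReal.toReal_ofNat, Real.rpow_ofNat,
      Real.rpow_ofNat, mul_pow, Real.sq_sqrt (abs_nonneg a)]
  simp_rw [h1]
  rw [integral_const_mul,
    Measure.integral_comp_mul_left (fun t => ‖g (t + b)‖ ^ (2 : ENNReal).toReal) a,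
    integral_add_right_eq_self (fun t => ‖g t‖ ^ (2 : ENNReal).toReal), abs_inv, smul_eq_mul,
    mul_inv_cancel_left₀ (abs_ne_zero.2 ha)]

lemma fourier : ExtendsToUnitary fun g => FourierTransform.fourier g :=
  of_linearEquiv (FourierTransform.fourierEquiv ℂ 𝓢(ℝ, ℂ)) SchwartzMap.norm_fourier_toL2_eq
    fun g => SchwartzMap.fourier_coe g

/-- Plancherel, followed by the dilation by -κ/(2π), whose Jacobian accounts for the prefactor. -/
lemma integral_phase {κ : ℝ} (hκ : κ ≠ 0) :
    ExtendsToUnitary fun g x =>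
      (√(|κ| / (2 * Real.pi)) : ℝ) * ∫ y, phase (κ * x * y) * g y := by
  have hp := Real.pi_pos
  have ha : -(κ / (2 * Real.pi)) ≠ 0 := neg_ne_zero.2 (by positivity)
  convert! (comp_affine ha 0).comp fourier using 4 with g x
  · rw [abs_neg, abs_div, abs_of_pos (by positivity : (0 : ℝ) < 2 * Real.pi)]
  · rw [Real.fourier_real_eq_integral_exp_smul]
    refine integral_congr_ae (Eventually.of_forall fun y => ?_)
    simp only
    rw [phase, smul_eq_mul]
    congr 2
    push_cast
    have : (Real.pi : ℂ) ≠ 0 := by exact_mod_cast hp.ne'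
    field_simp
    ring

end ExtendsToUnitary

/-! ### Matrix elements of the displacement operators. -/

lemma norm_iteratedFDeriv_comp_fst_le {E F : Type*} [NormedAddCommGroup E] [NormedSpace ℝ E]
    [NormedAddCommGroup F] [NormedSpace ℝ F] (f : 𝓢(E, ℂ)) (n : ℕ) (p : E × F) :
    ‖iteratedFDeriv ℝ n (fun q : E × F => f q.1) p‖ ≤ ‖iteratedFDeriv ℝ n f p.1‖ := by
  have h := (ContinuousLinearMap.fst ℝ E F).iteratedFDeriv_comp_right (f.smooth n) p
    (i := n) le_rfl
  have h' : (fun q : E × F => f q.1) = f ∘ ContinuousLinearMap.fst ℝ E F := rfl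
  rw [h', h]
  refine (ContinuousMultilinearMap.norm_compContinuousLinearMap_le _ _).trans ?_
  refine mul_le_of_le_one_right (norm_nonneg _) (Finset.prod_le_one (fun _ _ => norm_nonneg _) ?_)
  exact fun _ _ => ContinuousLinearMap.norm_fst_le ℝ E F

lemma norm_iteratedFDeriv_comp_snd_le {E F : Type*} [NormedAddCommGroup E] [NormedSpace ℝ E]
    [NormedAddCommGroup F] [NormedSpace ℝ F] (f : 𝓢(F, ℂ)) (n : ℕ) (p : E × F) :
    ‖iteratedFDeriv ℝ n (fun q : E × F => f q.2) p‖ ≤ ‖iteratedFDeriv ℝ n f p.2‖ := by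
  have h := (ContinuousLinearMap.snd ℝ E F).iteratedFDeriv_comp_right (f.smooth n) p
    (i := n) le_rfl
  have h' : (fun q : E × F => f q.2) = f ∘ ContinuousLinearMap.snd ℝ E F := rfl
  rw [h', h]
  refine (ContinuousMultilinearMap.norm_compContinuousLinearMap_le _ _).trans ?_
  refine mul_le_of_le_one_right (norm_nonneg _) (Finset.prod_le_one (fun _ _ => norm_nonneg _) ?_)
  exact fun _ _ => ContinuousLinearMap.norm_snd_le ℝ E F

/-- The tensor product of two Schwartz functions is a Schwartz function. -/
lemma isSchwartz_tensor {E F : Type*} [NormedAddCommGroup E] [NormedSpace ℝ E]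
    [NormedAddCommGroup F] [NormedSpace ℝ F] (f : 𝓢(E, ℂ)) (g : 𝓢(F, ℂ)) :
    IsSchwartz fun p : E × F => f p.1 * g p.2 := by
  have hf : ContDiff ℝ (⊤ : ℕ∞) fun p : E × F => f p.1 := (f.smooth ⊤).comp contDiff_fst
  have hg : ContDiff ℝ (⊤ : ℕ∞) fun p : E × F => g p.2 := (g.smooth ⊤).comp contDiff_snd
  refine ⟨⟨fun p => f p.1 * g p.2, hf.mul hg, fun k n => ?_⟩, rfl⟩
  choose A hA0 hA using fun k n => f.decay k n
  choose B hB0 hB using fun k n => g.decay k n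
  refine ⟨∑ i ∈ Finset.range (n + 1), (n.choose i : ℝ)
    * (A k i * B 0 (n - i) + A 0 i * B k (n - i)), fun p => ?_⟩
  refine (mul_le_mul_of_nonneg_left
    (norm_iteratedFDeriv_mul_le hf hg p (mod_cast le_top)) (by positivity)).trans ?_
  rw [Finset.mul_sum]
  refine Finset.sum_le_sum fun i _ => ?_
  have h1 := norm_iteratedFDeriv_comp_fst_le f i p
  have h2 := norm_iteratedFDeriv_comp_snd_le g (n - i) p
  have hk : ‖p‖ ^ k ≤ ‖p.1‖ ^ k + ‖p.2‖ ^ k := by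
    rw [Prod.norm_def]
    rcases max_choice ‖p.1‖ ‖p.2‖ with h | h <;> rw [h]
    · exact le_add_of_nonneg_right (by positivity)
    · exact le_add_of_nonneg_left (by positivity)
  have a0 := hA 0 i p.1
  have b0 := hB 0 (n - i) p.2
  rw [pow_zero, one_mul] at a0 b0
  calc ‖p‖ ^ k * ((n.choose i : ℝ) * ‖iteratedFDeriv ℝ i (fun p : E × F => f p.1) p‖
        * ‖iteratedFDeriv ℝ (n - i) (fun p : E × F => g p.2) p‖)
      ≤ (‖p.1‖ ^ k + ‖p.2‖ ^ k) * ((n.choose i : ℝ) * ‖iteratedFDeriv ℝ i f p.1‖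
        * ‖iteratedFDeriv ℝ (n - i) g p.2‖) := by gcongr
    _ = (n.choose i : ℝ) * ((‖p.1‖ ^ k * ‖iteratedFDeriv ℝ i f p.1‖)
          * ‖iteratedFDeriv ℝ (n - i) g p.2‖
        + ‖iteratedFDeriv ℝ i f p.1‖ * (‖p.2‖ ^ k * ‖iteratedFDeriv ℝ (n - i) g p.2‖)) := by ring
    _ ≤ _ := by
      gcongr
      · exact (hA0 k i).le
      · exact hA k i p.1
      · exact (hA0 0 i).le
      · exact hB k _ p.2

/-- The rotation `(s,t) ↦ ((t - s)/√2, -(s + t)/√2)`. -/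
def diagRotation : (ℝ × ℝ) ≃L[ℝ] ℝ × ℝ :=
  ContinuousLinearEquiv.equivOfInverse
    (((√2)⁻¹ • (ContinuousLinearMap.snd ℝ ℝ ℝ - ContinuousLinearMap.fst ℝ ℝ ℝ)).prod
      (-((√2)⁻¹ • (ContinuousLinearMap.fst ℝ ℝ ℝ + ContinuousLinearMap.snd ℝ ℝ ℝ))))
    ((-((√2)⁻¹ • (ContinuousLinearMap.fst ℝ ℝ ℝ + ContinuousLinearMap.snd ℝ ℝ ℝ))).prod
      ((√2)⁻¹ • (ContinuousLinearMap.fst ℝ ℝ ℝ - ContinuousLinearMap.snd ℝ ℝ ℝ)))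
    (fun p => by
      have h : (√2)⁻¹ * (√2)⁻¹ = (2 : ℝ)⁻¹ := by rw [← mul_inv, Real.mul_self_sqrt zero_le_two]
      ext
      · simp
        linear_combination (2 * p.1) * h
      · simp
        linear_combination (2 * p.2) * h)
    (fun p => by
      have h : (√2)⁻¹ * (√2)⁻¹ = (2 : ℝ)⁻¹ := by rw [← mul_inv, Real.mul_self_sqrt zero_le_two]
      ext
      · simp
        linear_combination (2 * p.1) * h
      · simp
        linear_combination (2 * p.2) * h)

lemma diagRotation_apply (p : ℝ × ℝ) : diagRotation p = ((p.2 - p.1) / √2, -(p.1 + p.2) / √2) := by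
  simp [diagRotation, ContinuousLinearEquiv.equivOfInverse]
  constructor <;> ring

lemma diagRotation_symm_apply (p : ℝ × ℝ) :
    diagRotation.symm p = (-(p.1 + p.2) / √2, (p.1 - p.2) / √2) := by
  have h : √2 * √2 = (2 : ℝ) := Real.mul_self_sqrt zero_le_two
  rw [ContinuousLinearEquiv.symm_apply_eq, diagRotation_apply]
  ext
  · simp only
    field_simp
    linear_combination p.1 * h
  · simp only
    field_simp
    linear_combination p.2 * h

/-- In the complex plane this is multiplication by the unit number (-1 + i)/√2. -/
lemma measurePreserving_diagRotation_symm : MeasurePreserving diagRotation.symm := by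
  have h : (√2)⁻¹ * (√2)⁻¹ = (2 : ℝ)⁻¹ := by rw [← mul_inv, Real.mul_self_sqrt zero_le_two]
  obtain ⟨w, hw⟩ : ∃ w : Circle, (w : ℂ) = ⟨-(√2)⁻¹, (√2)⁻¹⟩ := ⟨⟨⟨-(√2)⁻¹, (√2)⁻¹⟩, by
    refine mem_sphere_zero_iff_norm.2 ?_
    rw [← sq_eq_sq₀ (norm_nonneg _) zero_le_one, ← normSq_eq_norm_sq,
      normSq_mk, neg_mul_neg, h]
    norm_num⟩, rfl⟩
  have h1 := (Complex.volume_preserving_equiv_real_prod.comp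
    (rotation w).measurePreserving).comp
      (Complex.volume_preserving_equiv_real_prod.symm measurableEquivRealProd)
  convert! h1 using 1
  ext p
  · rw [diagRotation_symm_apply]
    simp [hw]
    ring
  · rw [diagRotation_symm_apply]
    simp [hw]
    ring

/-- The function `(s,t) ↦ conj f((t - s)/√2) g(-(s + t)/√2)`, from which the matrix elements of all
the operators `U(α,β;θ₁,θ₂)` come by fractional Fourier transforms. -/
def crossProduct (f g : ℝ → ℂ) (p : ℝ × ℝ) : ℂ :=
  conj (f ((p.2 - p.1) / √2)) * g (-(p.1 + p.2) / √2)

lemma isSchwartz_crossProduct (f g : 𝓢(ℝ, ℂ)) : IsSchwartz (crossProduct f g) := by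
  have h := (isSchwartz_tensor (SchwartzMap.postcompCLM (𝕜 := ℝ)
    (conjCLE.toContinuousLinearMap) f) g).comp_equiv diagRotation
  convert! h using 1
  ext p
  rw [diagRotation_apply]
  rfl

lemma sqrt_pi_mul_frftConst_pi_div_two :
    ((√Real.pi : ℝ) : ℂ) * frftConst (Real.pi / 2) = ((√2)⁻¹ : ℝ) := by
  have hp := Real.pi_pos
  have h : frftConst (Real.pi / 2) = ((√(2 * Real.pi))⁻¹ : ℝ) := by
    rw [frftConst, Real.cot_eq_cos_div_sin, Real.cos_pi_div_two, zero_div, ofReal_zero, mul_zero,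
      add_zero, ← Real.sqrt_inv, Real.sqrt_eq_rpow, ofReal_cpow (by positivity)]
    norm_num
  rw [h, ← ofReal_mul, Real.sqrt_mul zero_le_two]
  congr 1
  have : √Real.pi ≠ 0 := (Real.sqrt_pos.2 hp).ne'
  field_simp

lemma integral_comp_sqrt_two_mul_sub (φ : ℝ → ℂ) (a : ℝ) :
    ∫ x, φ (√2 * x - a) = ((√2)⁻¹ : ℝ) * ∫ u, φ u := by
  rw [Measure.integral_comp_mul_left (fun t => φ (t - a)) (√2), integral_sub_right_eq_self φ,
    abs_of_nonneg (by positivity), Complex.real_smul]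

lemma inner_toLp (f : 𝓢(ℝ, ℂ)) (G : Hilb) {g : ℝ → ℂ} (hg : G =ᵐ[volume] g) :
    ⟪f.toLp 2 volume, G⟫_ℂ = ∫ x, conj (f x) * g x := by
  rw [L2.inner_def]
  refine integral_congr_ae ?_
  filter_upwards [f.coeFn_toLp 2 volume, hg] with x h1 h2
  rw [h1, h2, RCLike.inner_apply']

/-- The matrix elements of the displacement operators. -/
lemma inner_D (f g : 𝓢(ℝ, ℂ)) (a b : ℝ) :
    ⟪f.toLp 2 volume, D a b (g.toLp 2 volume)⟫_ℂ
      = (√Real.pi : ℝ) * frftFst (Real.pi / 2) (crossProduct f g) (-b, a) := by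
  have hs2 : √2 * √2 = (2 : ℝ) := Real.mul_self_sqrt zero_le_two
  have hs0 : (√2 : ℝ) ≠ 0 := by positivity
  rw [inner_toLp f _ ((coeFn_D a b _).trans (dispFun_congr_ae a b (g.coeFn_toLp 2 volume))),
    frftFst, frft_of_sin_ne_zero (by simp), Real.cot_eq_cos_div_sin, Real.cos_pi_div_two,
    Real.sin_pi_div_two, ← mul_assoc, ← mul_assoc, sqrt_pi_mul_frftConst_pi_div_two]
  simp only [zero_div, neg_zero, zero_mul, phase_zero, mul_one, one_mul, div_one]
  -- The substitution s = a - √2 x, made in two moves, turns the arguments of `crossProduct` at t =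
  -- a into x and x - √2 a. The phase exp(-ibs) then contains the factor exp(-iab) of the
  -- displacement operator.
  conv_rhs => rw [← integral_neg_eq_self]
  rw [← integral_comp_sqrt_two_mul_sub _ a]
  refine integral_congr_ae (Eventually.of_forall fun x => ?_)
  simp only [crossProduct, dispFun]
  have e1 : (a - -(√2 * x - a)) / √2 = x := by
    field_simp
    ring
  have e2 : -(-(√2 * x - a) + a) / √2 = x - √2 * a := by
    field_simp
    linear_combination a * hs2
  rw [e1, e2, dispPhase, phase]
  have e3 : √2 * b * x - a * b = -b * -(√2 * x - a) := by ring
  rw [e3]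
  ring

/-! ### Unitarity of the bifractional displacement operators. -/

lemma ExtendsToUnitary.exists_inner_eq {S : (ℝ → ℂ) → ℝ → ℂ} (hS : ExtendsToUnitary S) :
    ∃ V ∈ unitary Op, ∀ f g : 𝓢(ℝ, ℂ),
      ⟪f.toLp 2 volume, V (g.toLp 2 volume)⟫_ℂ = ∫ x, conj (f x) * S g x := by
  obtain ⟨V, hV, h⟩ := hS
  refine ⟨V, hV, fun f g => ?_⟩
  obtain ⟨g', hg', hVg⟩ := h g
  rw [hVg, inner_toLp f _ (g'.coeFn_toLp 2 volume), hg']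

/-- In the degenerate cases the prefactor |sin(ω-τ)|^{1/2} is what compensates the modulus of the
kernel; √2 is the Jacobian of the substitution. -/
lemma norm_phase_mul_const_eq_one {ω τ t : ℝ} (h : |Real.sin (ω - τ)| = |Real.sin τ|)
    (hτ : Real.sin τ ≠ 0) :
    ‖((√|Real.sin (ω - τ)| : ℝ) : ℂ) * (√Real.pi : ℝ) * (√2 : ℝ) * frftConst τ * phase t‖ = 1 := by
  have hp := Real.pi_pos
  have hs : 0 < |Real.sin τ| := abs_pos.2 hτ
  refine (sq_eq_sq₀ (norm_nonneg _) zero_le_one).1 ?_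
  rw [norm_mul, norm_mul, norm_mul, norm_mul, norm_phase, mul_one, mul_pow, mul_pow, mul_pow,
    norm_frftConst_sq hτ, norm_real, norm_real, norm_real, Real.norm_eq_abs, Real.norm_eq_abs,
    Real.norm_eq_abs, sq_abs, sq_abs, sq_abs, Real.sq_sqrt (abs_nonneg _), Real.sq_sqrt hp.le,
    Real.sq_sqrt zero_le_two, h]
  field_simp

lemma integral_eq_sqrt_two_mul (φ : ℝ → ℂ) (a : ℝ) :
    ∫ u, φ u = (√2 : ℝ) * ∫ x, φ (√2 * x - a) := by
  rw [integral_comp_sqrt_two_mul_sub, ← mul_assoc, ← ofReal_mul, mul_inv_cancel₀ (by positivity),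
    ofReal_one, one_mul]

/-- The matrix elements of a bifractional displacement operator, up to the change of variables
`ω = θ₁ + π/2`, `τ = θ₂`. -/
def matrixElement (ω τ α β : ℝ) (f g : ℝ → ℂ) : ℂ :=
  (√|Real.sin (ω - τ)| : ℝ) * (√Real.pi : ℝ)
    * frftFst ω (frftSnd τ (crossProduct f g)) (α, β)

/-- The first transform freezes s = c = α cos ω. On this line, t = √2 x + c gives f the argument x
and g the argument -x - √2 c: the operator is a chirp times a reflected translation. -/
lemma exists_unitary_of_sin_fst_eq_zero {ω τ : ℝ} (hω : Real.sin ω = 0) (hτ : Real.sin τ ≠ 0)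
    (α β : ℝ) : ∃ V ∈ unitary Op, ∀ f g : 𝓢(ℝ, ℂ),
      ⟪f.toLp 2 volume, V (g.toLp 2 volume)⟫_ℂ = matrixElement ω τ α β f g := by
  have hs2 : √2 * √2 = (2 : ℝ) := Real.mul_self_sqrt zero_le_two
  have hs0 : (√2 : ℝ) ≠ 0 := by positivity
  have hsub : |Real.sin (ω - τ)| = |Real.sin τ| := by
    rw [Real.sin_sub, hω, zero_mul, zero_sub, abs_neg, abs_mul]
    rcases cos_eq_one_or_neg_one hω with h | h <;> simp [h]
  set c := Real.cos ω * α with hc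
  have hS := (ExtendsToUnitary.const_mul_phase_mul
    (q := fun x => β / Real.sin τ * (√2 * x - -c) + -(Real.cot τ / 2) * (√2 * x - -c) ^ 2)
    (by fun_prop) (norm_phase_mul_const_eq_one (t := -(Real.cot τ / 2) * β ^ 2) hsub hτ)).comp
      (ExtendsToUnitary.comp_affine (a := -1) (by norm_num) (-(√2 * c)))
  obtain ⟨V, hV, h⟩ := hS.exists_inner_eq
  refine ⟨V, hV, fun f g => ?_⟩
  rw [h, matrixElement, frftFst, frft_of_sin_eq_zero hω]
  simp only
  rw [← hc, frftSnd, frft_of_sin_ne_zero hτ]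
  simp only
  have hsubst := integral_eq_sqrt_two_mul (fun t => phase (β / Real.sin τ * t)
    * (phase (-(Real.cot τ / 2) * t ^ 2) * crossProduct f g (c, t))) (-c)
  rw [hsubst]
  simp only [← integral_const_mul]
  refine integral_congr_ae (Eventually.of_forall fun x => ?_)
  simp only [crossProduct]
  have e1 : (√2 * x - -c - c) / √2 = x := by
    field_simp
    ring
  have e2 : -(c + (√2 * x - -c)) / √2 = -1 * x + -(√2 * c) := by
    field_simp
    linear_combination c * hs2
  rw [e1, e2, phase_add]
  simp only [abs_neg, abs_one, Real.sqrt_one, ofReal_one]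
  ring

/-- Now t = c = β cos τ is frozen, and s = c - √2 x gives f and g the arguments x and x - √2 c: a
chirp times a translation. -/
lemma exists_unitary_of_sin_snd_eq_zero {ω τ : ℝ} (hω : Real.sin ω ≠ 0) (hτ : Real.sin τ = 0)
    (α β : ℝ) : ∃ V ∈ unitary Op, ∀ f g : 𝓢(ℝ, ℂ),
      ⟪f.toLp 2 volume, V (g.toLp 2 volume)⟫_ℂ = matrixElement ω τ α β f g := by
  have hs2 : √2 * √2 = (2 : ℝ) := Real.mul_self_sqrt zero_le_two
  have hs0 : (√2 : ℝ) ≠ 0 := by positivity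
  have hsub : |Real.sin (τ - ω)| = |Real.sin ω| := by
    rw [Real.sin_sub, hτ, zero_mul, zero_sub, abs_neg, abs_mul]
    rcases cos_eq_one_or_neg_one hτ with h | h <;> simp [h]
  set c := Real.cos τ * β with hc
  have hS := (ExtendsToUnitary.const_mul_phase_mul
    (q := fun x => α / Real.sin ω * -(√2 * x - c) + -(Real.cot ω / 2) * (-(√2 * x - c)) ^ 2)
    (by fun_prop) (norm_phase_mul_const_eq_one (t := -(Real.cot ω / 2) * α ^ 2) hsub hω)).comp
      (ExtendsToUnitary.comp_affine (a := 1) (by norm_num) (-(√2 * c)))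
  obtain ⟨V, hV, h⟩ := hS.exists_inner_eq
  refine ⟨V, hV, fun f g => ?_⟩
  have hcomm : |Real.sin (τ - ω)| = |Real.sin (ω - τ)| := by
    rw [← neg_sub, Real.sin_neg, abs_neg]
  have hslice : ∀ s, frftSnd τ (crossProduct f g) (s, β) = crossProduct f g (s, c) := by
    intro s
    rw [frftSnd, frft_of_sin_eq_zero hτ]
  rw [h, matrixElement, frftFst]
  simp only [hslice]
  rw [frft_of_sin_ne_zero hω]
  have hneg := (integral_neg_eq_self (fun t => phase (α / Real.sin ω * t)
    * (phase (-(Real.cot ω / 2) * t ^ 2) * crossProduct f g (t, c))) volume).symm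
  have hsubst := integral_eq_sqrt_two_mul (fun t => phase (α / Real.sin ω * -t)
    * (phase (-(Real.cot ω / 2) * (-t) ^ 2) * crossProduct f g (-t, c))) c
  rw [hneg, hsubst]
  simp only [← integral_const_mul]
  refine integral_congr_ae (Eventually.of_forall fun x => ?_)
  simp only [crossProduct]
  have e1 : (c - -(√2 * x - c)) / √2 = x := by
    field_simp
    ring
  have e2 : -(-(√2 * x - c) + c) / √2 = 1 * x + -(√2 * c) := by
    field_simp
    linear_combination c * hs2
  rw [e1, e2, phase_add, hcomm]
  simp only [abs_one, Real.sqrt_one, ofReal_one]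
  ring

/-- In the coordinates x = (t-s)/√2, y = -(s+t)/√2 the quadratic phase -(s² cot ω + t² cot τ)/2 is a
chirp in x, plus the same chirp in y, plus κxy. The operator is thus chirp, Fourier integral, chirp,
and sin(ω-τ) ≠ 0 says that κ ≠ 0. -/
lemma exists_unitary_of_sin_ne_zero {ω τ : ℝ} (hω : Real.sin ω ≠ 0) (hτ : Real.sin τ ≠ 0)
    (h : Real.sin (ω - τ) ≠ 0) (α β : ℝ) : ∃ V ∈ unitary Op, ∀ f g : 𝓢(ℝ, ℂ),
      ⟪f.toLp 2 volume, V (g.toLp 2 volume)⟫_ℂ = matrixElement ω τ α β f g := by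
  have hp := Real.pi_pos
  have hs2 : √2 * √2 = (2 : ℝ) := Real.mul_self_sqrt zero_le_two
  have hs0 : (√2 : ℝ) ≠ 0 := by positivity
  set κ := (Real.cot τ - Real.cot ω) / 2 with hκdef
  have hκeq : κ = Real.sin (ω - τ) / (2 * Real.sin ω * Real.sin τ) := by
    rw [hκdef, Real.cot_eq_cos_div_sin, Real.cot_eq_cos_div_sin, Real.sin_sub]
    field_simp
  have hκ : κ ≠ 0 := by
    rw [hκeq]
    exact div_ne_zero h (mul_ne_zero (mul_ne_zero two_ne_zero hω) hτ)
  set r : ℝ := √(|κ| / (2 * Real.pi)) with hr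
  have hr0 : 0 < r := Real.sqrt_pos.2 (by positivity)
  have hrc : (r : ℂ) ≠ 0 := by exact_mod_cast hr0.ne'
  set C : ℂ := ((√|Real.sin (ω - τ)| : ℝ) : ℂ) * (√Real.pi : ℝ) * frftConst ω * frftConst τ
    * phase (-(Real.cot ω / 2) * α ^ 2) * phase (-(Real.cot τ / 2) * β ^ 2) with hC
  -- The factor `r` belongs to the unitary Fourier integral, so what remains of the constant must be
  -- unimodular.
  have hζ : ‖C / r‖ = 1 := by
    have h1 : 0 < |Real.sin ω| := abs_pos.2 hω
    have h2 : 0 < |Real.sin τ| := abs_pos.2 hτ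
    have h3 : 0 < |Real.sin (ω - τ)| := abs_pos.2 h
    refine (sq_eq_sq₀ (norm_nonneg _) zero_le_one).1 ?_
    rw [norm_div, norm_real, Real.norm_of_nonneg hr0.le, div_pow, hr, Real.sq_sqrt (by positivity),
      hC, norm_mul, norm_mul, norm_mul, norm_mul, norm_mul, norm_phase, norm_phase, mul_one,
      mul_one, mul_pow, mul_pow, mul_pow, norm_frftConst_sq hτ, norm_frftConst_sq hω, norm_real,
      norm_real, Real.norm_eq_abs, Real.norm_eq_abs, sq_abs, sq_abs, Real.sq_sqrt (abs_nonneg _),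
      Real.sq_sqrt hp.le, hκeq, abs_div, abs_mul, abs_mul, abs_two]
    field_simp
  have hS := (ExtendsToUnitary.const_mul_phase_mul
    (q := fun x => -((Real.cot ω + Real.cot τ) / 4) * x ^ 2
      + (β / Real.sin τ - α / Real.sin ω) / √2 * x) (by fun_prop) hζ).comp
      ((ExtendsToUnitary.integral_phase hκ).comp
        (ExtendsToUnitary.const_mul_phase_mul (ζ := 1)
          (q := fun y => -((Real.cot ω + Real.cot τ) / 4) * y ^ 2
            + -(β / Real.sin τ + α / Real.sin ω) / √2 * y) (by fun_prop) norm_one))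
  obtain ⟨V, hV, hVS⟩ := hS.exists_inner_eq
  refine ⟨V, hV, fun f g => ?_⟩
  have hH := isSchwartz_crossProduct f g
  have hi := hH.integrable_kernelDensity_mul ω τ α β
  rw [hVS, matrixElement, ← hH.integral_kernelDensity_mul]
  rw [kernelMeasure_of_sin_ne_zero hω, kernelMeasure_of_sin_ne_zero hτ] at *
  have hemb : MeasurableEmbedding diagRotation.symm :=
    diagRotation.symm.toHomeomorph.measurableEmbedding
  have hmp := measurePreserving_diagRotation_symm
  rw [Measure.volume_eq_prod] at hmp
  have hprod := integral_prod _ ((hmp.integrable_comp_emb hemb).2 hi)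
  simp only [Function.comp_def] at hprod
  rw [← hmp.integral_comp hemb, hprod, ← integral_const_mul]
  refine integral_congr_ae (Eventually.of_forall fun x => ?_)
  simp only
  rw [← hr]
  simp only [← integral_const_mul]
  refine integral_congr_ae (Eventually.of_forall fun y => ?_)
  simp only [diagRotation_symm_apply, crossProduct]
  have e1 : ((x - y) / √2 - -(x + y) / √2) / √2 = x := by
    field_simp
    linear_combination -x * hs2
  have e2 : -(-(x + y) / √2 + (x - y) / √2) / √2 = y := by
    field_simp
    linear_combination -y * hs2
  rw [e1, e2, kernelDensity_of_sin_ne_zero hω, kernelDensity_of_sin_ne_zero hτ]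
  have e3 : phase (-((Real.cot ω + Real.cot τ) / 4) * x ^ 2
        + (β / Real.sin τ - α / Real.sin ω) / √2 * x) * (phase (κ * x * y)
        * phase (-((Real.cot ω + Real.cot τ) / 4) * y ^ 2
            + -(β / Real.sin τ + α / Real.sin ω) / √2 * y))
      = phase (α / Real.sin ω * (-(x + y) / √2)) * phase (-(Real.cot ω / 2) * (-(x + y) / √2) ^ 2)
        * (phase (β / Real.sin τ * ((x - y) / √2))
          * phase (-(Real.cot τ / 2) * ((x - y) / √2) ^ 2)) := by
    rw [← phase_add, ← phase_add, ← phase_add, ← phase_add, ← phase_add]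
    congr 1
    rw [hκdef, div_pow, div_pow, Real.sq_sqrt zero_le_two]
    ring
  have e4 : C / r * r = C := div_mul_cancel₀ _ hrc
  calc _ = (C / r * r) * (phase (-((Real.cot ω + Real.cot τ) / 4) * x ^ 2
        + (β / Real.sin τ - α / Real.sin ω) / √2 * x) * (phase (κ * x * y)
        * phase (-((Real.cot ω + Real.cot τ) / 4) * y ^ 2
            + -(β / Real.sin τ + α / Real.sin ω) / √2 * y))) * (conj (f x) * g y) := by ring
    _ = _ := by
      rw [e4, e3, hC]
      ring

lemma exists_unitary {ω τ : ℝ} (h : Real.sin (ω - τ) ≠ 0) (α β : ℝ) :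
    ∃ V ∈ unitary Op, ∀ f g : 𝓢(ℝ, ℂ),
      ⟪f.toLp 2 volume, V (g.toLp 2 volume)⟫_ℂ = matrixElement ω τ α β f g := by
  by_cases hω : Real.sin ω = 0
  · refine exists_unitary_of_sin_fst_eq_zero hω (fun hτ => h ?_) α β
    rw [Real.sin_sub, hω, hτ]
    ring
  · by_cases hτ : Real.sin τ = 0
    · exact exists_unitary_of_sin_snd_eq_zero hω hτ α β
    · exact exists_unitary_of_sin_ne_zero hω hτ h α β

/-! ### Operator integrals computed through matrix elements. -/

lemma HasKernelIntegral.kernelIntegral_eq {F : ℝ → ℝ → Op} {θ φ a b : ℝ} {A : Op}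
    (h : HasKernelIntegral F θ φ a b A) : kernelIntegral F θ φ a b = A := by
  have he : ∃ A, HasKernelIntegral F θ φ a b A := ⟨A, h⟩
  rw [kernelIntegral, dif_pos he]
  exact he.choose_spec.unique h

/-- Convergence is automatic when the matrix elements are Schwartz functions of the parameters; only
an identity between transforms is left. -/
lemma hasKernelIntegral_of_isSchwartz {F : ℝ → ℝ → Op} {θ φ a b : ℝ} {A : Op}
    (h : ∀ f g : 𝓢(ℝ, ℂ), ∃ H : ℝ × ℝ → ℂ, IsSchwartz H ∧
      (∀ p : ℝ × ℝ, ⟪f.toLp 2 volume, F p.1 p.2 (g.toLp 2 volume)⟫_ℂ = H p) ∧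
      frftFst θ (frftSnd φ H) (a, b) = ⟪f.toLp 2 volume, A (g.toLp 2 volume)⟫_ℂ) :
    HasKernelIntegral F θ φ a b A := by
  intro f g
  obtain ⟨H, hH, hFH, hA⟩ := h f g
  simp only [hFH]
  exact ⟨hH.integrable_kernelDensity_mul θ φ a b, by rw [hH.integral_kernelDensity_mul, hA]⟩

lemma frftFst_const_mul (θ : ℝ) (c : ℂ) (H : ℝ × ℝ → ℂ) :
    frftFst θ (fun p => c * H p) = fun p => c * frftFst θ H p := by
  ext p
  exact frft_const_mul θ c _ _

lemma frftSnd_const_mul (θ : ℝ) (c : ℂ) (H : ℝ × ℝ → ℂ) :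
    frftSnd θ (fun p => c * H p) = fun p => c * frftSnd θ H p := by
  ext p
  exact frft_const_mul θ c _ _

/-- Reconciles the point (-b,a) in `inner_D` with the point (β,-α) in the definition of U: parity
commutes with the transform, so the two signs cancel. -/
lemma frftFst_frftSnd_comp_quarterTurn (θ φ : ℝ) (G : ℝ × ℝ → ℂ) (x y : ℝ) :
    frftFst θ (frftSnd φ fun p => G (-p.2, p.1)) (y, -x) = frftSnd θ (frftFst φ G) (x, y) := by
  simp only [frftSnd, frftFst, frft_neg, neg_neg]

lemma inner_real_smul_apply (r : ℝ) (A : Op) (f g : Hilb) :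
    ⟪f, ((r : ℂ) • A) g⟫_ℂ = (r : ℂ) * ⟪f, A g⟫_ℂ := by
  rw [smul_apply, inner_smul_right]

/-- The quarter turn already contained in D adds to θ₁, whence ω = π/2 + θ₁ and sin(ω - θ₂) = cos(θ₁
- θ₂). -/
lemma exists_unitary_hasKernelIntegral {θ₁ θ₂ : ℝ} (h : Real.cos (θ₁ - θ₂) ≠ 0) (α β : ℝ) :
    ∃ V ∈ unitary Op,
    HasKernelIntegral D θ₂ θ₁ β (-α) ((((√|Real.cos (θ₁ - θ₂)|)⁻¹ : ℝ) : ℂ) • V) ∧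
    ∀ f g : 𝓢(ℝ, ℂ), ⟪f.toLp 2 volume, V (g.toLp 2 volume)⟫_ℂ
      = matrixElement (Real.pi / 2 + θ₁) θ₂ α β f g := by
  have hsin : Real.sin (Real.pi / 2 + θ₁ - θ₂) = Real.cos (θ₁ - θ₂) := by
    rw [add_sub_assoc, add_comm, Real.sin_add_pi_div_two]
  obtain ⟨V, hV, hVfg⟩ := exists_unitary (ω := Real.pi / 2 + θ₁) (τ := θ₂) (by rwa [hsin]) α β
  refine ⟨V, hV, hasKernelIntegral_of_isSchwartz fun f g => ?_, hVfg⟩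
  have hC := isSchwartz_crossProduct f g
  have hG := hC.isSchwartz_frftFst (Real.pi / 2)
  refine ⟨fun p => (√Real.pi : ℝ) * frftFst (Real.pi / 2) (crossProduct f g) (-p.2, p.1),
    ?_, fun p => inner_D f g p.1 p.2, ?_⟩
  · have := (hG.comp_mul_prod (a := -1) (b := 1) (by norm_num) one_ne_zero).comp_swap.const_mul
      (√Real.pi : ℝ)
    simpa only [neg_one_mul, one_mul] using this
  · have hc : ((√|Real.cos (θ₁ - θ₂)| : ℝ) : ℂ) ≠ 0 := by
      exact_mod_cast (Real.sqrt_pos.2 (abs_pos.2 h)).ne'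
    rw [inner_real_smul_apply, hVfg, matrixElement, hsin, ofReal_inv, mul_assoc,
      inv_mul_cancel_left₀ hc, frftSnd_const_mul, frftFst_const_mul,
      hC.frftFst_frftSnd_comm, ← hC.frftFst_frftFst]
    exact congrArg (_ * ·) (frftFst_frftSnd_comp_quarterTurn θ₂ θ₁ _ α β)

lemma hasKernelIntegral_D_and_U {θ₁ θ₂ : ℝ} (h : Real.cos (θ₁ - θ₂) ≠ 0) (α β : ℝ) :
    (∃ A, HasKernelIntegral D θ₂ θ₁ β (-α) A) ∧
    U α β θ₁ θ₂ ∈ unitary Op ∧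
    ∀ f g : 𝓢(ℝ, ℂ), ⟪f.toLp 2 volume, U α β θ₁ θ₂ (g.toLp 2 volume)⟫_ℂ
      = matrixElement (Real.pi / 2 + θ₁) θ₂ α β f g := by
  obtain ⟨V, hV, hVk, hVfg⟩ := exists_unitary_hasKernelIntegral h α β
  have hc : (√|Real.cos (θ₁ - θ₂)| : ℝ) ≠ 0 := (Real.sqrt_pos.2 (abs_pos.2 h)).ne'
  have hU : U α β θ₁ θ₂ = V := by
    rw [U, hVk.kernelIntegral_eq, smul_smul, ← ofReal_mul, mul_inv_cancel₀ hc, ofReal_one,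
      one_smul]
  exact ⟨⟨_, hVk⟩, hU ▸ hV, hU ▸ hVfg⟩

/-- The partial transforms commute and add their angles, so those of the family move from (π/2 + θ₁,
θ₂) to (π/2 + φ₁, φ₂); only the cosine prefactors differ. -/
lemma hasKernelIntegral_family {θ φ : ℝ × ℝ} (hθ : Real.cos (θ.1 - θ.2) ≠ 0)
    (hφ : Real.cos (φ.1 - φ.2) ≠ 0) (γ δ : ℝ) :
    HasKernelIntegral (family θ) (φ.1 - θ.1) (φ.2 - θ.2) γ δ
      (((√|Real.cos (θ.1 - θ.2)| / √|Real.cos (φ.1 - φ.2)| : ℝ) : ℂ) • family φ γ δ) := by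
  refine hasKernelIntegral_of_isSchwartz fun f g => ?_
  have hsin : ∀ a b : ℝ, Real.sin (Real.pi / 2 + a - b) = Real.cos (a - b) := fun a b => by
    rw [add_sub_assoc, add_comm, Real.sin_add_pi_div_two]
  have hC := isSchwartz_crossProduct f g
  refine ⟨_, ((hC.isSchwartz_frftSnd θ.2).isSchwartz_frftFst (Real.pi / 2 + θ.1)).const_mul
    ((√|Real.cos (θ.1 - θ.2)| : ℝ) * (√Real.pi : ℝ)), fun p => ?_, ?_⟩
  · rw [family, (hasKernelIntegral_D_and_U hθ _ _).2.2, matrixElement, hsin]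
  · have hc : ((√|Real.cos (φ.1 - φ.2)| : ℝ) : ℂ) ≠ 0 := by
      exact_mod_cast (Real.sqrt_pos.2 (abs_pos.2 hφ)).ne'
    rw [inner_real_smul_apply, family, (hasKernelIntegral_D_and_U hφ _ _).2.2,
      matrixElement, hsin, frftSnd_const_mul, frftFst_const_mul,
      hC.frftFst_frftSnd_comm, (hC.isSchwartz_frftFst _).frftSnd_frftSnd,
      ← hC.frftFst_frftSnd_comm, (hC.isSchwartz_frftSnd _).frftFst_frftFst]
    have e1 : θ.2 + (φ.2 - θ.2) = φ.2 := by ring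
    have e2 : Real.pi / 2 + θ.1 + (φ.1 - θ.1) = Real.pi / 2 + φ.1 := by ring
    rw [e1, e2]
    push_cast
    field_simp

/-- The difference of the angles lies in (-π, π), where the cosine vanishes only at ±π/2. -/
lemma cos_ne_zero_of_mem_angleDomain {θ : ℝ × ℝ} (hθ : θ ∈ angleDomain) :
    Real.cos (θ.1 - θ.2) ≠ 0 := by
  obtain ⟨⟨⟨h1, h2⟩, h3, h4⟩, h5, h6⟩ := hθ
  have hp := Real.pi_pos
  intro h
  obtain ⟨k, hk⟩ := Real.cos_eq_zero_iff.1 h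
  have hlt : (k : ℝ) < 1 := by
    by_contra! hk1
    nlinarith
  have hgt : (-2 : ℝ) < k := by
    by_contra! hk1
    nlinarith
  have hlt' : k < 1 := by exact_mod_cast hlt
  have hgt' : -2 < k := by exact_mod_cast hgt
  obtain rfl | rfl : k = 0 ∨ k = -1 := by omega
  · exact h5 (by rw [hk]; push_cast; ring)
  · exact h6 (by rw [hk]; push_cast; ring)

/-- The integral transform from the angles `θ` to the angles `φ` maps the first family of operators
to the second one. -/
lemma transform_family {θ φ : ℝ × ℝ} (hθ : θ ∈ angleDomain) (hφ : φ ∈ angleDomain) :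
    transform θ φ (family θ) = family φ := by
  have hθ' := cos_ne_zero_of_mem_angleDomain hθ
  have hφ' := cos_ne_zero_of_mem_angleDomain hφ
  have h1 := (Real.sqrt_pos.2 (abs_pos.2 hθ')).ne'
  have h2 := (Real.sqrt_pos.2 (abs_pos.2 hφ')).ne'
  ext1 γ
  ext1 δ
  rw [transform, (hasKernelIntegral_family hθ' hφ' γ δ).kernelIntegral_eq, smul_smul,
    ← ofReal_mul, div_mul_div_cancel₀ h1, div_self h2, ofReal_one, one_smul]

/-! ### The arrows and the pair groupoid. -/

/-- From here on the integrals play no role: the map depends on the parameters only through the two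
operators, so possible coincidences U_x = U_x' do no harm. -/
lemma T_eq (x y : Param) : T x y = fun A => ⟨A = x.U, fun _ => y.U⟩ := by
  unfold T
  rw [transform_family x.mem y.mem]
  rfl

/-- The arrow with given source and target. -/
def arrowBetween (u v : base) : arrows :=
  ⟨fun A => ⟨A = u, fun _ => v⟩, by
    obtain ⟨_, x, rfl⟩ := u
    obtain ⟨_, y, rfl⟩ := v
    exact ⟨x, y, (T_eq x y).symm⟩⟩

lemma exists_eq_arrowBetween (t : arrows) : ∃ p : base × base, t = arrowBetween p.1 p.2 := by
  obtain ⟨_, x, y, rfl⟩ := t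
  exact ⟨(point x, point y), Subtype.ext (T_eq x y)⟩

/-- The source of an arrow. -/
def source (t : arrows) : base := (exists_eq_arrowBetween t).choose.1

/-- The target of an arrow. -/
def target (t : arrows) : base := (exists_eq_arrowBetween t).choose.2

lemma arrowBetween_source_target (t : arrows) : arrowBetween (source t) (target t) = t :=
  (exists_eq_arrowBetween t).choose_spec.symm

/-- A partial map defined at a single point remembers that point and its value. This makes the
chosen `source` and `target` independent of the choice. -/
lemma arrowBetween_inj {u v u' v' : base} (h : arrowBetween u v = arrowBetween u' v') :
    u = u' ∧ v = v' := by
  have h0 : (arrowBetween u v : Op →. Op) = arrowBetween u' v' := congrArg Subtype.val h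
  have h1 : (v : Op) ∈ (arrowBetween u' v' : Op →. Op) (u : Op) := by
    rw [← h0]
    exact ⟨rfl, rfl⟩
  obtain ⟨hu, hv⟩ := h1
  exact ⟨Subtype.ext hu, Subtype.ext hv.symm⟩

@[simp]
lemma source_arrowBetween (u v : base) : source (arrowBetween u v) = u :=
  (arrowBetween_inj (arrowBetween_source_target (arrowBetween u v))).1

@[simp]
lemma target_arrowBetween (u v : base) : target (arrowBetween u v) = v :=
  (arrowBetween_inj (arrowBetween_source_target (arrowBetween u v))).2

lemma arrow_eq (x y : Param) : arrow x y = arrowBetween (point x) (point y) :=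
  Subtype.ext (T_eq x y)

lemma comp_arrowBetween (u v w : base) :
    (arrowBetween v w : Op →. Op).comp (arrowBetween u v : Op →. Op) = ↑(arrowBetween u w) := by
  refine PFun.ext fun A B => ?_
  rw [PFun.comp_apply]
  refine Part.mem_bind_iff.trans ?_
  constructor
  · rintro ⟨_, ⟨hA, _⟩, _, hB⟩
    exact ⟨hA, hB⟩
  · rintro ⟨hA, hB⟩
    exact ⟨v, ⟨hA, rfl⟩, rfl, hB⟩

/-- Serves both kinds of identities: they are loops at the source (left) or at the target (right) of
t. -/
lemma bijOn_source_range {f : arrows → base} (hf : f.Surjective) :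
    Set.BijOn source (Set.range fun t => arrowBetween (f t) (f t)) Set.univ := by
  refine ⟨fun _ _ => Set.mem_univ _, ?_, fun u _ => ?_⟩
  · rintro _ ⟨t, rfl⟩ _ ⟨t', rfl⟩ h
    simp only [source_arrowBetween] at h
    simp only [h]
  · obtain ⟨t, rfl⟩ := hf u
    exact ⟨_, ⟨t, rfl⟩, source_arrowBetween _ _⟩

/-- The groupoid of the bifractional displacement operators. -/
def groupoid : GroupoidOver arrows base where
  src := source
  tgt := target
  mul t₁ t₂ _ := arrowBetween (source t₁) (target t₂)
  src_mul _ _ _ := source_arrowBetween _ _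
  tgt_mul _ _ _ := target_arrowBetween _ _
  mul_assoc _ _ _ _ _ := by simp
  inv t := arrowBetween (target t) (source t)
  inv_inv t := by simp [arrowBetween_source_target]
  src_inv _ := source_arrowBetween _ _
  tgt_inv _ := target_arrowBetween _ _
  leftId_mul t := by simp [arrowBetween_source_target]
  mul_rightId t := by simp [arrowBetween_source_target]
  bijOn_leftId := by
    simp only [target_arrowBetween]
    exact bijOn_source_range fun u => ⟨arrowBetween u u, source_arrowBetween _ _⟩
  bijOn_rightId := by
    simp only [source_arrowBetween]
    exact bijOn_source_range fun u => ⟨arrowBetween u u, target_arrowBetween _ _⟩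

end Bifractional

end

theorem mainTheorem1 :
    -- the operators `U(α,β;θ₁,θ₂)` are well defined by their integral, and unitary
    (∀ x : Bifractional.Param,
      (∃ A, Bifractional.HasKernelIntegral Bifractional.D x.θ.2 x.θ.1 x.β (-x.α) A) ∧
      x.U ∈ unitary Bifractional.Op) ∧
    -- the integral that defines `T(x|y)` exists, and `T(x|y)` sends `U_x`, its only argument, to `U_y`
    (∀ x y : Bifractional.Param,
      (∃ A, Bifractional.HasKernelIntegral (Bifractional.family x.θ)
        (y.θ.1 - x.θ.1) (y.θ.2 - x.θ.2) y.α y.β A) ∧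
      (Bifractional.T x y).Dom = {x.U} ∧
      y.U ∈ Bifractional.T x y x.U) ∧
    -- compatibility, for the iterated integral transforms and for the maps
    (∀ θ ∈ Bifractional.angleDomain, ∀ φ ∈ Bifractional.angleDomain,
      ∀ ψ ∈ Bifractional.angleDomain,
        Bifractional.transform φ ψ (Bifractional.transform θ φ (Bifractional.family θ))
          = Bifractional.transform θ ψ (Bifractional.family θ)) ∧
    (∀ x y z : Bifractional.Param,
      (Bifractional.T y z).comp (Bifractional.T x y) = Bifractional.T x z) ∧
    -- the connected groupoid
    ∃ G : Bifractional.GroupoidOver Bifractional.arrows Bifractional.base,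
      (∀ x y, G.src (Bifractional.arrow x y) = Bifractional.point x ∧
        G.tgt (Bifractional.arrow x y) = Bifractional.point y) ∧
      (∀ t₁ t₂ h, ((G.mul t₁ t₂ h : Bifractional.arrows) : Bifractional.Op →. Bifractional.Op)
        = (t₂ : Bifractional.Op →. Bifractional.Op).comp t₁) ∧
      (∀ x y, G.inv (Bifractional.arrow x y) = Bifractional.arrow y x) ∧
      (∀ x y, G.leftId (Bifractional.arrow x y) = Bifractional.arrow x x ∧
        G.rightId (Bifractional.arrow x y) = Bifractional.arrow y y) ∧
      G.IsConnected := by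
  refine ⟨fun x => ?_, fun x y => ⟨?_, ?_, ?_⟩, fun θ hθ φ hφ ψ hψ => ?_, fun x y z => ?_,
    Bifractional.groupoid, fun x y => ?_, fun t₁ t₂ h => ?_, fun x y => ?_, fun x y => ?_,
    fun u v => ?_⟩
  · have h := Bifractional.hasKernelIntegral_D_and_U
      (Bifractional.cos_ne_zero_of_mem_angleDomain x.mem) x.α x.β
    exact ⟨h.1, h.2.1⟩
  · exact ⟨_, Bifractional.hasKernelIntegral_family
      (Bifractional.cos_ne_zero_of_mem_angleDomain x.mem)
      (Bifractional.cos_ne_zero_of_mem_angleDomain y.mem) _ _⟩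
  · rfl
  · rw [Bifractional.T_eq]
    exact ⟨rfl, rfl⟩
  · rw [Bifractional.transform_family hθ hφ, Bifractional.transform_family hφ hψ,
      Bifractional.transform_family hθ hψ]
  · rw [Bifractional.T_eq, Bifractional.T_eq, Bifractional.T_eq]
    exact Bifractional.comp_arrowBetween (Bifractional.point x) (Bifractional.point y)
      (Bifractional.point z)
  · rw [Bifractional.arrow_eq]
    exact ⟨Bifractional.source_arrowBetween _ _, Bifractional.target_arrowBetween _ _⟩
  · have h1 := Bifractional.arrowBetween_source_target t₁
    have h2 := Bifractional.arrowBetween_source_target t₂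
    change Bifractional.target t₁ = Bifractional.source t₂ at h
    -- Both factors are written with the common middle vertex, as `comp_arrowBetween` requires.
    conv_rhs => rw [← h1, ← h2, h]
    exact (Bifractional.comp_arrowBetween _ _ _).symm
  · rw [Bifractional.arrow_eq, Bifractional.arrow_eq]
    simp [Bifractional.groupoid]
  · rw [Bifractional.arrow_eq, Bifractional.arrow_eq, Bifractional.arrow_eq]
    simp [Bifractional.groupoid, Bifractional.GroupoidOver.leftId,
      Bifractional.GroupoidOver.rightId]
  · exact ⟨Bifractional.arrowBetween u v, Bifractional.source_arrowBetween _ _,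
      Bifractional.target_arrowBetween _ _⟩
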